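/- Conventions. Manifolds are smooth, Hausdorff, second countable and without boundary; forms are smooth; a submanifold is an injectively immersed manifold. A \emph{stable Hamiltonian structure} $(\omega,\lambda)$ on a manifold $M$ of dimension $2n+1$ consists of a closed $2$-form $\omega$ and a $1$-form $\lambda$ such that $\lambda\wedge\omega^n$ vanishes nowhere and $\ker\omega\subseteq\ker d\lambda$. Then $\flat(v)=i_v\omega+\lambda(v)\lambda$ is an isomorphism $TM\to T^*M$; let $\sharp=\flat^{-1}$, let $\mathcal R=\sharp(\lambda)$ be the Reeb vector field, let $\mathcal H=\ker\lambda$, let $\Lambda(\alpha,\beta)=\omega(\sharp\alpha,\sharp\beta)$, and let $\sharp_\Lambda(\alpha)=i_\alpha\Lambda$. For a subspace $\Delta\subseteq T_qM$ with annihilator $\Delta^0$ put $\Delta^{\perp_\Lambda}=\sharp_\Lambda(\Delta^0)$. A submanifold $N$ of $M$ is \emph{coisotropic} if $(T_qN)^{\perp_\Lambda}\subseteq T_qN$ for all $q\in N$, \emph{Lagrangian} if $(T_qN)^{\perp_\Lambda}=T_qN\cap\mathcal H_q$ for all $q\in N$, \emph{vertical} if $\mathcal R(q)\in T_qN$ for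 all $q\in N$, \emph{horizontal} if $T_qN\subseteq\mathcal H_q$ for all $q\in N$, and \emph{non-horizontal} if $T_qN\not\subseteq\mathcal H_q$ for all $q\in N$. \textbf{Theorem (vertical coisotropic reduction in stable Hamiltonian structures).} Let $(M,\omega,\lambda)$ be a stable Hamiltonian structure and let $i:N\hookrightarrow M$ be a non-empty vertical coisotropic submanifold such that the distribution $(TN)^{\perp_\Lambda}$ on $N$ is integrable. Let $\mathcal F$ be the set of its leaves (maximal connected integral manifolds), and suppose that $N/\mathcal F$ admits a manifold structure for which the canonical projection $\pi:N\to N/\mathcal F$ is a submersion. Suppose that $i^*d\lambda$ vanishes on $TN\cap\mathcal H$, that is, $d\lambda(u,v)=0$ for all $q\in N$ and $u,v\in T_qN\cap\mathcal H_q$. (1) There is a unique stable Hamiltonian structure $(\omega_N,\lambda_N)$ on $N/\mathcal F$ such that $\pi^*\omega_N=i^*\omega$ and $\pi^*\lambda_N=i^*\lambda$. (2) Suppose in addition that $N$ is embedded in $M$. Let $L\hookrightarrow M$ be a Lagrangian submanifold that meets $N$ cleanly, that is, $L\cap N$ is a submanifold of $M$ and $T_q(L\cap N)=T_qL\cap T_qN$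 for all $q\in L\cap N$. Suppose that $L_N=\pi(L\cap N)$ is an embedded submanifold of $N/\mathcal F$, and that $L\cap N$ is horizontal, or $L\cap N$ is non-horizontal, or $\pi|_{L\cap N}:L\cap N\to L_N$ is a submersion. Then $L_N$ is a Lagrangian submanifold of $(N/\mathcal F,\omega_N,\lambda_N)$. -/

import Mathlib

open Set Manifold
open scoped ContDiff Topology

namespace SHS

universe u

/-! ### Linear algebra of a pair `(om, lam)` on a vector space -/

section LinearAlgebra

theorem update_zero_pair {W : Type*} (u v w : W) : Function.update ![u, v] 0 w = ![w, v] := by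
  ext j; fin_cases j <;> simp

theorem update_one_pair {W : Type*} (u v w : W) : Function.update ![u, v] 1 w = ![u, w] := by
  ext j; fin_cases j <;> simp

variable {V : Type*} [AddCommGroup V] [Module ℝ V]

/-- An alternating `1`-form as a covector. -/
def covector (lam : V [⋀^Fin 1]→ₗ[ℝ] ℝ) : Module.Dual ℝ V where
  toFun v := lam ![v]
  map_add' u v := by
    have h := lam.map_update_add ![u] 0 u v
    have e : ∀ w : V, Function.update ![u] 0 w = ![w] := fun w => by
      ext j; fin_cases j; simp
    rwa [e, e, e] at h
  map_smul' c v := by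
    have h := lam.map_update_smul ![v] 0 c v
    have e : ∀ w : V, Function.update ![v] 0 w = ![w] := fun w => by
      ext j; fin_cases j; simp
    rwa [e, e] at h

/-- An alternating `2`-form as a bilinear form. -/
def bilin (om : V [⋀^Fin 2]→ₗ[ℝ] ℝ) : V →ₗ[ℝ] Module.Dual ℝ V :=
  LinearMap.mk₂ ℝ (fun u v => om ![u, v])
    (fun u u' v => by
      have h := om.map_update_add ![u, v] 0 u u'
      rwa [update_zero_pair, update_zero_pair, update_zero_pair] at h)
    (fun c u v => by
      have h := om.map_update_smul ![u, v] 0 c u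
      rwa [update_zero_pair, update_zero_pair] at h)
    (fun u v v' => by
      have h := om.map_update_add ![u, v] 1 v v'
      rwa [update_one_pair, update_one_pair, update_one_pair] at h)
    (fun c u v => by
      have h := om.map_update_smul ![u, v] 1 c v
      rwa [update_one_pair, update_one_pair] at h)

/-- The value of `lam ∧ om ∧ ⋯ ∧ om` (`n` factors `om`) on the vectors `v 0, …, v (2 n)`, with the
convention `(α ∧ β)(v) = 1 / (p! q!) ∑ σ, sign σ * α (v ∘ σ) * β (v ∘ σ)`. -/
noncomputable def wedgeTop (n : ℕ) (om : V [⋀^Fin 2]→ₗ[ℝ] ℝ) (lam : V [⋀^Fin 1]→ₗ[ℝ] ℝ)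
    (v : Fin (2 * n + 1) → V) : ℝ :=
  ((2 : ℝ) ^ n)⁻¹ * ∑ σ : Equiv.Perm (Fin (2 * n + 1)), ((Equiv.Perm.sign σ : ℤ) : ℝ) *
    (lam ![v (σ 0)] * ∏ j : Fin n,
      om ![v (σ ⟨2 * j + 1, by omega⟩), v (σ ⟨2 * j + 2, by omega⟩)])

/-- `♭ v = i_v om + lam(v) lam`. -/
def flat (om : V [⋀^Fin 2]→ₗ[ℝ] ℝ) (lam : V [⋀^Fin 1]→ₗ[ℝ] ℝ) : V →ₗ[ℝ] Module.Dual ℝ V :=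
  bilin om + (covector lam).smulRight (covector lam)

open Classical in
/-- `♯`, the inverse of `♭` (set to `0` if `♭` is not bijective, which does not happen for a
stable Hamiltonian structure). -/
noncomputable def sharp (om : V [⋀^Fin 2]→ₗ[ℝ] ℝ) (lam : V [⋀^Fin 1]→ₗ[ℝ] ℝ) :
    Module.Dual ℝ V →ₗ[ℝ] V :=
  if h : Function.Bijective (flat om lam) then
    ((LinearEquiv.ofBijective (flat om lam) h).symm : Module.Dual ℝ V →ₗ[ℝ] V)
  else 0

/-- The bivector `Λ(α, β) = om(♯ α, ♯ β)`. -/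
noncomputable def bivector (om : V [⋀^Fin 2]→ₗ[ℝ] ℝ) (lam : V [⋀^Fin 1]→ₗ[ℝ] ℝ) :
    Module.Dual ℝ V →ₗ[ℝ] Module.Dual ℝ (Module.Dual ℝ V) :=
  (bilin om).compl₁₂ (sharp om lam) (sharp om lam)

/-- `♯_Λ α = i_α Λ`, the vector `v` with `β v = Λ(α, β)` for all covectors `β`. -/
noncomputable def sharpBivector [FiniteDimensional ℝ V] (om : V [⋀^Fin 2]→ₗ[ℝ] ℝ)
    (lam : V [⋀^Fin 1]→ₗ[ℝ] ℝ) : Module.Dual ℝ V →ₗ[ℝ] V :=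
  ((Module.evalEquiv ℝ V).symm : Module.Dual ℝ (Module.Dual ℝ V) →ₗ[ℝ] V) ∘ₗ bivector om lam

/-- The `Λ`-orthogonal `W^{⊥Λ} = ♯_Λ (W⁰)`, with `W⁰` the annihilator of `W`. -/
noncomputable def orth [FiniteDimensional ℝ V] (om : V [⋀^Fin 2]→ₗ[ℝ] ℝ)
    (lam : V [⋀^Fin 1]→ₗ[ℝ] ℝ) (W : Submodule ℝ V) : Submodule ℝ V :=
  W.dualAnnihilator.map (sharpBivector om lam)

/-- The Reeb vector `♯ lam`. -/
noncomputable def reeb (om : V [⋀^Fin 2]→ₗ[ℝ] ℝ) (lam : V [⋀^Fin 1]→ₗ[ℝ] ℝ) : V :=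
  sharp om lam (covector lam)

/-- The horizontal space `ker lam`. -/
def horizontal (lam : V [⋀^Fin 1]→ₗ[ℝ] ℝ) : Submodule ℝ V :=
  LinearMap.ker (covector lam)

end LinearAlgebra

/-! ### Differential forms on manifolds -/

section Forms

/-- Not necessarily smooth differential `k`-forms on a manifold of dimension `d`. -/
abbrev Form (d : ℕ) (M : Type*) [TopologicalSpace M] [ChartedSpace (EuclideanSpace ℝ (Fin d)) M]
    (k : ℕ) : Type _ :=
  ∀ x : M, TangentSpace (𝓡 d) x [⋀^Fin k]→L[ℝ] ℝ

variable {d : ℕ} {M : Type*} [TopologicalSpace M] [ChartedSpace (EuclideanSpace ℝ (Fin d)) M]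
  {k : ℕ}

noncomputable instance (x : M) : FiniteDimensional ℝ (TangentSpace (𝓡 d) x) :=
  inferInstanceAs (FiniteDimensional ℝ (EuclideanSpace ℝ (Fin d)))

/-- The expression of a form in the preferred chart at `c`: its pullback along the inverse chart
(meaningful on the target of the chart). -/
noncomputable def Form.inChart (α : Form d M k) (c : M) (y : EuclideanSpace ℝ (Fin d)) :
    EuclideanSpace ℝ (Fin d) [⋀^Fin k]→L[ℝ] ℝ :=
  (α ((extChartAt (𝓡 d) c).symm y)).compContinuousLinearMap
    (mfderiv (𝓡 d) (𝓡 d) (extChartAt (𝓡 d) c).symm y)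

/-- A form is smooth if all its chart expressions are. -/
def Form.Smooth (α : Form d M k) : Prop :=
  ∀ c : M, ContDiffOn ℝ ∞ (α.inChart c) (extChartAt (𝓡 d) c).target

/-- The exterior derivative, computed at each point `x` in the preferred chart at `x`. -/
noncomputable def Form.extD (α : Form d M k) : Form d M (k + 1) := fun x =>
  (extDeriv (α.inChart x) (extChartAt (𝓡 d) x x)).compContinuousLinearMap
    (mfderiv (𝓡 d) (𝓡 d) (extChartAt (𝓡 d) x) x)

/-- The pullback `f^* α`. -/
noncomputable def Form.pullback (e : ℕ) {N : Type*} [TopologicalSpace N]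
    [ChartedSpace (EuclideanSpace ℝ (Fin e)) N] (f : N → M) (α : Form d M k) : Form e N k :=
  fun q => (α (f q)).compContinuousLinearMap (mfderiv (𝓡 e) (𝓡 d) f q)

/-- `(M, om, lam)` is a stable Hamiltonian structure: `dim M = 2 n + 1`, `om` is a closed smooth
`2`-form, `lam` is a smooth `1`-form, `lam ∧ om ^ n` vanishes nowhere, `ker om ⊆ ker (d lam)`. -/
structure IsStableHamiltonian (om : Form d M 2) (lam : Form d M 1) : Prop where
  smooth_omega : om.Smooth
  smooth_lam : lam.Smooth
  closed : om.extD = 0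
  volume : ∃ n : ℕ, d = 2 * n + 1 ∧ ∀ x : M, ∃ v : Fin (2 * n + 1) → TangentSpace (𝓡 d) x,
    wedgeTop n (om x).toAlternatingMap (lam x).toAlternatingMap v ≠ 0
  ker_le : ∀ (x : M) (v : TangentSpace (𝓡 d) x),
    (∀ w, om x ![v, w] = 0) → ∀ w, lam.extD x ![v, w] = 0

end Forms

/-! ### Submanifolds, integral manifolds, leaves -/

section Submanifolds

variable (e d : ℕ) {M : Type*} [TopologicalSpace M] [ChartedSpace (EuclideanSpace ℝ (Fin d)) M]
  {N : Type u} [TopologicalSpace N] [ChartedSpace (EuclideanSpace ℝ (Fin e)) N]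

/-- The tangent space of a submanifold `f : N → M` at `f q`, as a subspace of `T_{f q} M`. Tangent
spaces are copies of the model space, so those of two submanifolds at a
common point can be compared. -/
noncomputable def tanSpace (f : N → M) (q : N) : Submodule ℝ (EuclideanSpace ℝ (Fin d)) :=
  LinearMap.range (mfderiv (𝓡 e) (𝓡 d) f q : TangentSpace (𝓡 e) q →ₗ[ℝ] TangentSpace (𝓡 d) (f q))

/-- An injectively immersed submanifold. -/
structure IsSubmanifold (f : N → M) : Prop where
  immersion : IsImmersion (𝓡 e) (𝓡 d) ∞ f
  injective : Function.Injective f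

variable {d}

/-- The `Λ`-orthogonal of the tangent space of a submanifold, in `T_{f q} M`. -/
noncomputable def tanOrth (om : Form d M 2) (lam : Form d M 1) (f : N → M) (q : N) :
    Submodule ℝ (EuclideanSpace ℝ (Fin d)) :=
  orth (V := TangentSpace (𝓡 d) (f q)) (om (f q)).toAlternatingMap (lam (f q)).toAlternatingMap
    (tanSpace e d f q)

/-- The horizontal space `ker lam` at the point `x`. -/
noncomputable def hor (lam : Form d M 1) (x : M) : Submodule ℝ (EuclideanSpace ℝ (Fin d)) :=
  horizontal (V := TangentSpace (𝓡 d) x) (lam x).toAlternatingMap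

/-- Coisotropic: `(TN)^{⊥Λ} ⊆ TN`. -/
def IsCoisotropic (om : Form d M 2) (lam : Form d M 1) (f : N → M) : Prop :=
  ∀ q, tanOrth e om lam f q ≤ tanSpace e d f q

/-- Lagrangian: `(TN)^{⊥Λ} = TN ∩ ker lam`. -/
def IsLagrangian (om : Form d M 2) (lam : Form d M 1) (f : N → M) : Prop :=
  ∀ q, tanOrth e om lam f q = tanSpace e d f q ⊓ hor lam (f q)

/-- Vertical: the Reeb vector field is tangent to the submanifold. -/
def IsVertical (om : Form d M 2) (lam : Form d M 1) (f : N → M) : Prop :=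
  ∀ q, reeb (V := TangentSpace (𝓡 d) (f q)) (om (f q)).toAlternatingMap
    (lam (f q)).toAlternatingMap ∈ tanSpace e d f q

variable {e}

/-- A field of tangent subspaces. -/
abbrev Distribution (e : ℕ) (N : Type*) [TopologicalSpace N]
    [ChartedSpace (EuclideanSpace ℝ (Fin e)) N] : Type _ :=
  ∀ q : N, Submodule ℝ (TangentSpace (𝓡 e) q)

/-- `(TN)^{⊥Λ}` as a distribution on `N`: the vectors of `T_q N` that `df` sends to
`(T_q N)^{⊥Λ}`. -/
noncomputable def charDistribution (e : ℕ) {N : Type u} [TopologicalSpace N]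
    [ChartedSpace (EuclideanSpace ℝ (Fin e)) N] (om : Form d M 2) (lam : Form d M 1) (f : N → M) :
    Distribution e N := fun q =>
  (tanOrth e om lam f q).comap
    (mfderiv (𝓡 e) (𝓡 d) f q : TangentSpace (𝓡 e) q →ₗ[ℝ] TangentSpace (𝓡 d) (f q))

/-- `S` is the image of a connected integral manifold of `D`: a connected (Hausdorff, second
countable) manifold, injectively immersed in `N`, whose tangent spaces are the spaces of `D`. -/
def IsIntegralManifold (D : Distribution e N) (S : Set N) : Prop :=
  ∃ (r : ℕ) (X : Type u) (_ : TopologicalSpace X) (_ : ChartedSpace (EuclideanSpace ℝ (Fin r)) X)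
    (_ : IsManifold (𝓡 r) ∞ X) (_ : T2Space X) (_ : SecondCountableTopology X)
    (_ : ConnectedSpace X) (s : X → N),
    IsSubmanifold r e s ∧ range s = S ∧
      ∀ x, LinearMap.range (mfderiv (𝓡 r) (𝓡 e) s x :
        TangentSpace (𝓡 r) x →ₗ[ℝ] TangentSpace (𝓡 e) (s x)) = D (s x)

/-- Every point lies on an integral manifold. -/
def IsIntegrable (D : Distribution e N) : Prop :=
  ∀ q, ∃ S, q ∈ S ∧ IsIntegralManifold D S

/-- A leaf is a maximal connected integral manifold. -/
def IsLeaf (D : Distribution e N) (S : Set N) : Prop :=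
  Maximal (IsIntegralManifold D) S

/-- `π : N → B` exhibits `B` as the set of leaves of `D`: it is onto and its fibres are exactly
the leaves. -/
def IsLeafProjection {B : Type*} (D : Distribution e N) (π : N → B) : Prop :=
  Function.Surjective π ∧ ∀ S : Set N, IsLeaf D S ↔ ∃ y, S = π ⁻¹' {y}

/-- The submanifolds `i : N → M` and `j : L → M` intersect cleanly and `k : P → M` is their
intersection: `k` is a submanifold, `P = N ∩ L` and `TP = TN ∩ TL`. -/
structure IsCleanIntersection (d e l p : ℕ) {M N L P : Type*}
    [TopologicalSpace M] [ChartedSpace (EuclideanSpace ℝ (Fin d)) M]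
    [TopologicalSpace N] [ChartedSpace (EuclideanSpace ℝ (Fin e)) N]
    [TopologicalSpace L] [ChartedSpace (EuclideanSpace ℝ (Fin l)) L]
    [TopologicalSpace P] [ChartedSpace (EuclideanSpace ℝ (Fin p)) P]
    (i : N → M) (j : L → M) (k : P → M) : Prop where
  submanifold : IsSubmanifold p d k
  range_eq : range k = range i ∩ range j
  tan_eq : ∀ x q z, i q = k x → j z = k x →
    tanSpace p d k x = tanSpace e d i q ⊓ tanSpace l d j z

end Submanifolds

/-- `(omN, lamN)` is a stable Hamiltonian structure on `B` with `π^* omN = i^* om` and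
`π^* lamN = i^* lam`. -/
structure IsReduced {d : ℕ} (e : ℕ) {b : ℕ} {M N B : Type*}
    [TopologicalSpace M] [ChartedSpace (EuclideanSpace ℝ (Fin d)) M]
    [TopologicalSpace N] [ChartedSpace (EuclideanSpace ℝ (Fin e)) N]
    [TopologicalSpace B] [ChartedSpace (EuclideanSpace ℝ (Fin b)) B]
    (om : Form d M 2) (lam : Form d M 1) (i : N → M) (π : N → B)
    (omN : Form b B 2) (lamN : Form b B 1) : Prop where
  stable : IsStableHamiltonian omN lamN
  pullback_omega : omN.pullback e π = om.pullback e i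
  pullback_lam : lamN.pullback e π = lam.pullback e i

end SHS

/-! At each point `ω` is symplectic on `ker λ` and the Reeb vector `R` spans a complement. Since
`♯_Λ (♭ a) = λ(a) R - a`, the Λ-orthogonal of `W` is the symplectic complement of `W ∩ ker λ` inside
`ker λ` (`mem_orth`). The theorem is therefore symplectic coisotropic reduction with the direction
`R` carried along; verticality keeps `R` tangent to `N`.

Part (1). The fibres of `π` are the leaves, and a dimension argument shows `ker dπ = (TN)^{⊥Λ}`
(`range_modelDeriv_eq_ker`). Hence `i^*ω` and `i^*λ` vanish as soon as one argument lies in `ker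
dπ`. Both are closed: `i^*dλ` vanishes on horizontal vectors by assumption and on `R` because `ker ω
⊆ ker dλ`. A closed form that vanishes on `ker dπ` is constant along the connected fibres, so it
descends (`exists_descended_form`). The image of `R` is a Reeb vector of the descended pair, which
gives the volume condition; `λ_N` is closed, so the kernel condition is automatic. Uniqueness
follows from the surjectivity of `π` and `dπ`.

Part (2). Pointwise, write `H = ker λ`. For `L` Lagrangian and `C` coisotropic containing `R`, `(L ∩
C)^⊥ = (L ∩ H) + C^⊥`, so the image of `L ∩ C` in `C / C^⊥` is Lagrangian (`orth_map_comap`). It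
remains to identify `T L_N` with `dπ(T(L ∩ N))`. The chain rule gives one inclusion; the submersion
hypothesis is the other. In the horizontal and non-horizontal cases the dimension formula
`finrank_map_comap` shows that `π` has constant rank on `L ∩ N`, and a constant-rank map onto a
manifold of dimension `c` has rank at least `c`: its image has Hausdorff dimension at most its rank
(`dimH_image_le_of_finrank_range_mfderiv`). The same bound identifies the tangent spaces of the
leaves. -/

namespace SHS

/-! ### The Λ-orthogonal as a symplectic complement inside `ker lam` -/

section LinearAlgebra

variable {V : Type*} [AddCommGroup V] [Module ℝ V]
  {om : V [⋀^Fin 2]→ₗ[ℝ] ℝ} {lam : V [⋀^Fin 1]→ₗ[ℝ] ℝ}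

theorem bilin_apply (om : V [⋀^Fin 2]→ₗ[ℝ] ℝ) (u v : V) : bilin om u v = om ![u, v] := rfl

theorem covector_apply (lam : V [⋀^Fin 1]→ₗ[ℝ] ℝ) (v : V) : covector lam v = lam ![v] := rfl

theorem bilin_self (om : V [⋀^Fin 2]→ₗ[ℝ] ℝ) (u : V) : bilin om u u = 0 :=
  om.map_eq_zero_of_eq ![u, u] (i := 0) (j := 1) rfl (by decide)

theorem bilin_swap (om : V [⋀^Fin 2]→ₗ[ℝ] ℝ) (u v : V) : bilin om u v = -bilin om v u := by
  have h := bilin_self om (u + v)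
  simp only [map_add, LinearMap.add_apply, bilin_self] at h
  linarith

theorem flat_apply (u v : V) :
    flat om lam u v = bilin om u v + covector lam u * covector lam v := rfl

theorem mem_horizontal {v : V} : v ∈ horizontal lam ↔ covector lam v = 0 := LinearMap.mem_ker

/-- `R` is a Reeb vector of the pair `(om, lam)`, which is nondegenerate. -/
structure IsReebVector (om : V [⋀^Fin 2]→ₗ[ℝ] ℝ) (lam : V [⋀^Fin 1]→ₗ[ℝ] ℝ) (R : V) : Prop where
  bilin_eq : bilin om R = 0
  covector_eq : covector lam R = 1
  eq_zero : ∀ v, bilin om v = 0 → covector lam v = 0 → v = 0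

theorem IsReebVector.bilin_left {R : V} (h : IsReebVector om lam R) (v : V) :
    bilin om R v = 0 := by rw [h.bilin_eq]; rfl

theorem IsReebVector.bilin_right {R : V} (h : IsReebVector om lam R) (v : V) :
    bilin om v R = 0 := by rw [bilin_swap, h.bilin_left, neg_zero]

theorem flat_injective (h : ∀ v, bilin om v = 0 → covector lam v = 0 → v = 0) :
    Function.Injective (flat om lam) := by
  refine (injective_iff_map_eq_zero _).2 fun v hv => ?_
  -- Evaluating `♭ v = 0` on `v` itself leaves `lam(v)² = 0`.
  have h1 : covector lam v = 0 := by
    have := LinearMap.congr_fun hv v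
    rw [flat_apply, bilin_self] at this
    simpa using this
  refine h v ?_ h1
  ext w
  have := LinearMap.congr_fun hv w
  simpa [flat_apply, h1] using this

variable [FiniteDimensional ℝ V] {R : V}

theorem flat_bijective (h : ∀ v, bilin om v = 0 → covector lam v = 0 → v = 0) :
    Function.Bijective (flat om lam) :=
  ⟨flat_injective h, (LinearMap.injective_iff_surjective_of_finrank_eq_finrank
    Subspace.dual_finrank_eq.symm).1 (flat_injective h)⟩

namespace IsReebVector

variable (h : IsReebVector om lam R)
include h

theorem sharp_flat (v : V) : sharp om lam (flat om lam v) = v := by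
  rw [sharp, dif_pos (flat_bijective h.eq_zero)]
  exact (LinearEquiv.ofBijective (flat om lam) (flat_bijective h.eq_zero)).symm_apply_apply v

omit [FiniteDimensional ℝ V] in
theorem flat_self : flat om lam R = covector lam := by
  ext v
  rw [flat_apply, h.bilin_left, h.covector_eq]; ring

theorem reeb_eq : reeb om lam = R := by
  rw [reeb, ← h.flat_self, h.sharp_flat]

/-- Pairing with `♭ b`: since `om(b, R) = 0` and `lam (lam(a) R - a) = 0`, the vector on the right
gives `-om(b, a) = Λ(♭ a, ♭ b)`. Up to sign, `♯_Λ ∘ ♭` is thus the projection to `ker lam` along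
`R`. -/
theorem sharpBivector_flat (a : V) :
    sharpBivector om lam (flat om lam a) = covector lam a • R - a := by
  rw [sharpBivector, LinearMap.comp_apply, LinearEquiv.coe_coe, LinearEquiv.symm_apply_eq]
  ext β
  obtain ⟨b, rfl⟩ := (flat_bijective h.eq_zero).2 β
  rw [bivector, LinearMap.compl₁₂_apply, h.sharp_flat, h.sharp_flat, Module.evalEquiv_apply,
    Module.Dual.eval_apply, flat_apply]
  simp only [map_sub, map_smul, h.bilin_right, h.covector_eq, smul_eq_mul]
  rw [bilin_swap om a b]; ring

/-- All later linear algebra goes through this description: `orth W` is the `om`-complement of `W ∩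
ker lam` taken inside `ker lam`, with no mention of `♯` or `Λ`. -/
theorem mem_orth {W : Submodule ℝ V} {v : V} :
    v ∈ orth om lam W ↔ covector lam v = 0 ∧ ∀ w ∈ W, covector lam w = 0 → bilin om v w = 0 := by
  constructor
  · rintro ⟨α, hα, rfl⟩
    obtain ⟨a, rfl⟩ := (flat_bijective h.eq_zero).2 α
    rw [h.sharpBivector_flat]
    refine ⟨by simp [h.covector_eq], fun w hw hw0 => ?_⟩
    have := (Submodule.mem_dualAnnihilator _).1 hα w hw
    rw [flat_apply, hw0] at this
    simp only [map_sub, map_smul, LinearMap.sub_apply, LinearMap.smul_apply, h.bilin_left]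
    simpa using this
  · rintro ⟨hv, hw⟩
    -- On `W` the functional `om(v, ·)` vanishes on the kernel of `lam`, so it is a multiple of
    -- `lam` there.
    obtain ⟨c, hc⟩ : ∃ c : ℝ, ∀ w ∈ W, bilin om v w = c * covector lam w := by
      by_cases hW : ∀ w ∈ W, covector lam w = 0
      · exact ⟨0, fun w hwW => by rw [hw w hwW (hW w hwW), zero_mul]⟩
      · push Not at hW
        obtain ⟨w₀, hw₀, h0⟩ := hW
        refine ⟨bilin om v w₀ / covector lam w₀, fun w hwW => ?_⟩
        have := hw (w - (covector lam w / covector lam w₀) • w₀)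
          (W.sub_mem hwW (W.smul_mem _ hw₀)) (by simp [h0])
        simp only [map_sub, map_smul, smul_eq_mul] at this
        field_simp at this ⊢
        linarith
    -- This covector is `-om(v, ·) + c lam`, which annihilates `W` by the choice of `c`, and `♯_Λ`
    -- sends it back to `v`.
    refine ⟨flat om lam (c • R - v), ?_, ?_⟩
    · rw [SetLike.mem_coe, Submodule.mem_dualAnnihilator]
      intro w hwW
      rw [flat_apply]
      simp only [map_sub, map_smul, LinearMap.sub_apply, LinearMap.smul_apply, h.bilin_left,
        h.covector_eq, hv, hc w hwW, smul_eq_mul]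
      ring
    · rw [h.sharpBivector_flat]
      simp [h.covector_eq, hv]

theorem orth_le_horizontal (W : Submodule ℝ V) : orth om lam W ≤ horizontal lam :=
  fun _ hv => mem_horizontal.2 (h.mem_orth.1 hv).1

/-- `♭` identifies `orth W` with the annihilator of `(W ∩ ker lam) ⊕ ℝ R`; the summand `ℝ R`
accounts for the `1`. -/
theorem finrank_orth_add (W : Submodule ℝ V) :
    Module.finrank ℝ (orth om lam W) + Module.finrank ℝ ↥(W ⊓ horizontal lam) + 1 =
      Module.finrank ℝ V := by
  set K := W ⊓ horizontal lam with hK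
  have hR : R ≠ 0 := fun h0 => by simpa [h0] using h.covector_eq
  have h1 : orth om lam W = (K ⊔ ℝ ∙ R).dualAnnihilator.comap (flat om lam) := by
    ext v
    rw [h.mem_orth, Submodule.mem_comap, Submodule.mem_dualAnnihilator]
    constructor
    · rintro ⟨hv, hw⟩ x hx
      obtain ⟨k, hk, r, hr, rfl⟩ := Submodule.mem_sup.1 hx
      obtain ⟨c, rfl⟩ := Submodule.mem_span_singleton.1 hr
      simp only [map_add, map_smul, flat_apply, hw k hk.1 (mem_horizontal.1 hk.2), hv,
        h.bilin_right]
      simp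
    · intro hx
      have hv : covector lam v = 0 := by
        have := hx R (Submodule.mem_sup_right (Submodule.mem_span_singleton_self R))
        simpa [flat_apply, h.bilin_right, h.covector_eq] using this
      refine ⟨hv, fun w hw hw0 => ?_⟩
      have := hx w (Submodule.mem_sup_left ⟨hw, mem_horizontal.2 hw0⟩)
      simpa [flat_apply, hv] using this
  have h2 : Module.finrank ℝ (orth om lam W) =
      Module.finrank ℝ (K ⊔ ℝ ∙ R).dualAnnihilator := by
    rw [h1]
    exact LinearEquiv.finrank_eq ((LinearEquiv.ofBijective (flat om lam)
      (flat_bijective h.eq_zero)).ofSubmodule' _)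
  have h3 : K ⊓ (ℝ ∙ R) = ⊥ := by
    rw [eq_bot_iff]
    rintro x ⟨hx, hr⟩
    obtain ⟨c, rfl⟩ := Submodule.mem_span_singleton.1 hr
    have := mem_horizontal.1 hx.2
    rw [map_smul, h.covector_eq] at this
    simp only [smul_eq_mul, mul_one] at this
    simp [this]
  have h4 := Submodule.finrank_sup_add_finrank_inf_eq K (ℝ ∙ R)
  rw [h3, finrank_bot, finrank_span_singleton hR] at h4
  have h5 := Subspace.finrank_add_finrank_dualAnnihilator_eq (K ⊔ ℝ ∙ R)
  omega

/-- One inclusion is antisymmetry of `om`; equality follows by applying the dimension formula twice.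
-/
theorem orth_orth (W : Submodule ℝ V) : orth om lam (orth om lam W) = W ⊓ horizontal lam := by
  symm
  apply Submodule.eq_of_le_of_finrank_eq
  · rintro w ⟨hw, hw0⟩
    refine h.mem_orth.2 ⟨mem_horizontal.1 hw0, fun v hv _ => ?_⟩
    rw [bilin_swap, (h.mem_orth.1 hv).2 w hw (mem_horizontal.1 hw0), neg_zero]
  · have h1 := h.finrank_orth_add W
    have h2 := h.finrank_orth_add (orth om lam W)
    rw [inf_eq_left.2 (h.orth_le_horizontal W)] at h2
    omega

theorem orth_sup_inf (A C : Submodule ℝ V) :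
    orth om lam ((A ⊓ horizontal lam) ⊔ (C ⊓ horizontal lam)) =
      orth om lam A ⊓ orth om lam C := by
  ext v
  rw [Submodule.mem_inf, h.mem_orth, h.mem_orth, h.mem_orth]
  constructor
  · rintro ⟨hv, hw⟩
    exact ⟨⟨hv, fun w hw1 hw0 => hw w (Submodule.mem_sup_left ⟨hw1, hw0⟩) hw0⟩,
      ⟨hv, fun w hw1 hw0 => hw w (Submodule.mem_sup_right ⟨hw1, hw0⟩) hw0⟩⟩
  · rintro ⟨⟨hv, h1⟩, -, h2⟩
    refine ⟨hv, fun w hw _ => ?_⟩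
    obtain ⟨a, ha, c, hc, rfl⟩ := Submodule.mem_sup.1 hw
    rw [map_add, h1 a ha.1 ha.2, h2 c hc.1 hc.2, add_zero]

/-- In the symplectic space `ker lam`, the complement of `L ∩ C` is `L + C^⊥` for Lagrangian `L`. -/
theorem orth_inf_of_lagrangian {L C : Submodule ℝ V}
    (hL : orth om lam L = L ⊓ horizontal lam) :
    orth om lam (L ⊓ C) = (L ⊓ horizontal lam) ⊔ orth om lam C := by
  -- The complement of the sum `L^⊥ + C^⊥` is `L ∩ C ∩ ker lam`; a second complement recovers the
  -- sum.
  have h1 := h.orth_sup_inf (orth om lam L) (orth om lam C)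
  rw [inf_eq_left.2 (h.orth_le_horizontal L), inf_eq_left.2 (h.orth_le_horizontal C), h.orth_orth,
    h.orth_orth] at h1
  have h2 := h.orth_orth (orth om lam L ⊔ orth om lam C)
  rw [h1, inf_eq_left.2 (sup_le (h.orth_le_horizontal L) (h.orth_le_horizontal C)), hL] at h2
  rw [← h2]
  ext v
  rw [h.mem_orth, h.mem_orth]
  refine and_congr_right fun _ => ⟨fun hw w hwm _ => hw w ⟨hwm.1.1, hwm.2.1⟩ hwm.1.2,
    fun hw w hwm h0 => hw w ⟨⟨hwm.1, h0⟩, hwm.2, h0⟩ h0⟩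

theorem finrank_lagrangian {L : Submodule ℝ V} (hL : orth om lam L = L ⊓ horizontal lam) :
    2 * Module.finrank ℝ ↥(L ⊓ horizontal lam) + 1 = Module.finrank ℝ V := by
  have := h.finrank_orth_add L
  rw [hL] at this
  omega

/-- For Lagrangian `L`, `L ∩ C^⊥ = L^⊥ ∩ C^⊥` is the complement of `(L ∩ ker lam) + (C ∩ ker lam)`,
whose dimension is known from the intersection. -/
theorem finrank_inf_orth {L C : Submodule ℝ V} (hL : orth om lam L = L ⊓ horizontal lam) :
    Module.finrank ℝ ↥(L ⊓ orth om lam C) + Module.finrank ℝ ↥(C ⊓ horizontal lam) =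
      Module.finrank ℝ ↥(L ⊓ horizontal lam) + Module.finrank ℝ ↥(L ⊓ C ⊓ horizontal lam) := by
  have h1 : L ⊓ orth om lam C = orth om lam L ⊓ orth om lam C := by
    rw [hL, inf_assoc, inf_eq_right.2 (h.orth_le_horizontal C)]
  have h2 := h.finrank_orth_add ((L ⊓ horizontal lam) ⊔ (C ⊓ horizontal lam))
  rw [h.orth_sup_inf, ← h1, inf_eq_left.2 (sup_le (inf_le_right (a := L))
    (inf_le_right (a := C)))] at h2
  have h3 := Submodule.finrank_sup_add_finrank_inf_eq (L ⊓ horizontal lam) (C ⊓ horizontal lam)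
  have h4 := h.finrank_lagrangian hL
  rw [← inf_inf_distrib_right] at h3
  omega

end IsReebVector

end LinearAlgebra

/-! ### Nonvanishing of `lam ∧ om ^ n` forces `ker om ∩ ker lam = 0` -/

section Wedge

variable {V : Type*} [AddCommGroup V] [Module ℝ V]

/-- Each slot enters exactly one factor: slot `0` enters `lam`, and slot `i > 0` enters the factor
with index `(i - 1) / 2`, on the left for odd `i` and on the right for even `i`. This makes the
product multilinear, so `wedgeTop` becomes an alternatization. -/
theorem exists_linear_wedge_update (n : ℕ) (om : V [⋀^Fin 2]→ₗ[ℝ] ℝ) (lam : V [⋀^Fin 1]→ₗ[ℝ] ℝ)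
    (v : Fin (2 * n + 1) → V) (i : Fin (2 * n + 1)) : ∃ ℓ : V →ₗ[ℝ] ℝ, ∀ z,
      covector lam (Function.update v i z 0) * ∏ j : Fin n,
        bilin om (Function.update v i z ⟨2 * j + 1, by omega⟩)
          (Function.update v i z ⟨2 * j + 2, by omega⟩) = ℓ z := by
  have h : ∀ z : V, ∀ k : Fin (2 * n + 1), k ≠ i → Function.update v i z k = v k :=
    fun z k hk => Function.update_of_ne hk _ _
  by_cases hi : i = 0
  · subst hi
    refine ⟨(∏ j : Fin n, bilin om (v ⟨2 * j + 1, by omega⟩) (v ⟨2 * j + 2, by omega⟩)) •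
      covector lam, fun z => ?_⟩
    rw [Function.update_self, LinearMap.smul_apply, smul_eq_mul, mul_comm]
    congr 1
  have hi' : (i : ℕ) ≠ 0 := fun h0 => hi (Fin.ext h0)
  have hj : ((i : ℕ) - 1) / 2 < n := by omega
  have key : ∀ z, covector lam (Function.update v i z 0) * ∏ j : Fin n,
        bilin om (Function.update v i z ⟨2 * j + 1, by omega⟩)
          (Function.update v i z ⟨2 * j + 2, by omega⟩) =
      (covector lam (v 0) * ∏ j ∈ (Finset.univ : Finset (Fin n)).erase ⟨((i : ℕ) - 1) / 2, hj⟩,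
        bilin om (v ⟨2 * j + 1, by omega⟩) (v ⟨2 * j + 2, by omega⟩)) *
      bilin om (Function.update v i z ⟨2 * (((i : ℕ) - 1) / 2) + 1, by omega⟩)
          (Function.update v i z ⟨2 * (((i : ℕ) - 1) / 2) + 2, by omega⟩) := by
    intro z
    rw [h z 0 (Ne.symm hi), ← Finset.mul_prod_erase _ _ (Finset.mem_univ ⟨((i : ℕ) - 1) / 2, hj⟩),
      mul_comm (bilin om _ _), ← mul_assoc]
    congr 2
    refine Finset.prod_congr rfl fun j hj => ?_
    have hne : (j : ℕ) ≠ ((i : ℕ) - 1) / 2 := fun h0 => Finset.ne_of_mem_erase hj (Fin.ext h0)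
    rw [h z _ fun h0 => hne (by have := Fin.ext_iff.1 h0; simp only at this; omega),
      h z _ fun h0 => hne (by have := Fin.ext_iff.1 h0; simp only at this; omega)]
  simp only [key]
  generalize covector lam (v 0) * _ = c
  rcases Nat.even_or_odd' (i : ℕ) with ⟨k, hk | hk⟩
  · refine ⟨c • bilin om (v ⟨2 * (((i : ℕ) - 1) / 2) + 1, by omega⟩), fun z => ?_⟩
    have h1 : (⟨2 * (((i : ℕ) - 1) / 2) + 2, by omega⟩ : Fin (2 * n + 1)) = i :=
      Fin.ext (by simp only; omega)
    rw [h1, Function.update_self, h z _ fun h0 => by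
      have := Fin.ext_iff.1 h0; simp only at this; omega]
    rfl
  · refine ⟨c • (bilin om).flip (v ⟨2 * (((i : ℕ) - 1) / 2) + 2, by omega⟩), fun z => ?_⟩
    have h1 : (⟨2 * (((i : ℕ) - 1) / 2) + 1, by omega⟩ : Fin (2 * n + 1)) = i :=
      Fin.ext (by simp only; omega)
    rw [h1, Function.update_self, h z _ fun h0 => by
      have := Fin.ext_iff.1 h0; simp only at this; omega]
    rfl

/-- The multilinear map `v ↦ lam (v 0) * ∏ j, om (v (2 j + 1), v (2 j + 2))`. -/
def wedgeMonomial (n : ℕ) (om : V [⋀^Fin 2]→ₗ[ℝ] ℝ) (lam : V [⋀^Fin 1]→ₗ[ℝ] ℝ) :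
    MultilinearMap ℝ (fun _ : Fin (2 * n + 1) => V) ℝ :=
  MultilinearMap.mk' (fun v => covector lam (v 0) * ∏ j : Fin n,
      bilin om (v ⟨2 * j + 1, by omega⟩) (v ⟨2 * j + 2, by omega⟩))
    (fun v i x y => by
      obtain ⟨ℓ, hℓ⟩ := exists_linear_wedge_update n om lam v i
      simp only [hℓ, map_add])
    (fun v i c x => by
      obtain ⟨ℓ, hℓ⟩ := exists_linear_wedge_update n om lam v i
      simp only [hℓ, map_smul])

theorem wedgeMonomial_apply (n : ℕ) (om : V [⋀^Fin 2]→ₗ[ℝ] ℝ) (lam : V [⋀^Fin 1]→ₗ[ℝ] ℝ)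
    (v : Fin (2 * n + 1) → V) : wedgeMonomial n om lam v = covector lam (v 0) * ∏ j : Fin n,
      bilin om (v ⟨2 * j + 1, by omega⟩) (v ⟨2 * j + 2, by omega⟩) := rfl

theorem wedgeTop_eq (n : ℕ) (om : V [⋀^Fin 2]→ₗ[ℝ] ℝ) (lam : V [⋀^Fin 1]→ₗ[ℝ] ℝ)
    (v : Fin (2 * n + 1) → V) : wedgeTop n om lam v =
      ((2 : ℝ) ^ n)⁻¹ * MultilinearMap.alternatization (wedgeMonomial n om lam) v := by
  rw [wedgeTop, MultilinearMap.alternatization_apply]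
  congr 1
  refine Finset.sum_congr rfl fun σ _ => ?_
  rw [MultilinearMap.domDomCongr_apply, wedgeMonomial_apply, Units.smul_def, zsmul_eq_mul]
  rfl

/-- If `lam ∧ om ^ n` does not vanish in dimension `2 n + 1`, then `ker om ∩ ker lam = 0`. -/
theorem eq_zero_of_wedgeTop_ne_zero [FiniteDimensional ℝ V] {n : ℕ} {om : V [⋀^Fin 2]→ₗ[ℝ] ℝ}
    {lam : V [⋀^Fin 1]→ₗ[ℝ] ℝ} (hn : Module.finrank ℝ V = 2 * n + 1)
    {v : Fin (2 * n + 1) → V} (hv : wedgeTop n om lam v ≠ 0) (u : V) (h1 : bilin om u = 0)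
    (h2 : covector lam u = 0) : u = 0 := by
  by_contra hu
  rw [wedgeTop_eq] at hv
  set A := MultilinearMap.alternatization (wedgeMonomial n om lam) with hA
  -- Every term of the alternatization feeds `u` to `lam` or to some `om`, and both kill it.
  have hu0 : ∀ (w : Fin (2 * n + 1) → V) (i : Fin (2 * n + 1)), w i = u → A w = 0 := by
    intro w i hi
    rw [hA, MultilinearMap.alternatization_apply]
    refine Finset.sum_eq_zero fun σ _ => ?_
    rw [MultilinearMap.domDomCongr_apply, wedgeMonomial_apply]
    obtain ⟨k, rfl⟩ := σ.surjective i
    have hb : ∀ x, bilin om x u = 0 := fun x => by rw [bilin_swap, h1]; simp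
    by_cases hk : k = 0
    · rw [← hk, hi, h2, zero_mul, smul_zero]
    · have hk' : (k : ℕ) ≠ 0 := fun h0 => hk (Fin.ext h0)
      rw [Finset.prod_eq_zero (Finset.mem_univ (⟨((k : ℕ) - 1) / 2, by omega⟩ : Fin n)), mul_zero,
        smul_zero]
      rcases Nat.even_or_odd' (k : ℕ) with ⟨j, hj | hj⟩
      · rw [show (⟨2 * (((k : ℕ) - 1) / 2) + 2, by omega⟩ : Fin (2 * n + 1)) = k from
          Fin.ext (by simp only; omega), hi, hb]
      · rw [show (⟨2 * (((k : ℕ) - 1) / 2) + 1, by omega⟩ : Fin (2 * n + 1)) = k from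
          Fin.ext (by simp only; omega), hi, h1]
        rfl
  have hli : LinearIndependent ℝ v := by
    by_contra h
    exact hv (by rw [A.map_linearDependent v h, mul_zero])
  have hspan := hli.span_eq_top_of_card_eq_finrank' (by rw [hn, Fintype.card_fin])
  obtain ⟨c, hc⟩ := (Submodule.mem_span_range_iff_exists_fun ℝ).1
    (show u ∈ Submodule.span ℝ (range v) by rw [hspan]; trivial)
  obtain ⟨i, hi⟩ : ∃ i, c i ≠ 0 := by
    by_contra! h
    exact hu (by rw [← hc]; simp [h])
  -- As `A v ≠ 0`, the vectors `v` form a basis. Replacing `v i` by `u` multiplies `A v` by the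
  -- coordinate `c i ≠ 0`, yet gives `0`.
  have h3 : A (Function.update v i u) = c i * A v := by
    rw [← hc, A.map_update_sum, Finset.sum_eq_single i]
    · rw [A.map_update_smul, Function.update_eq_self, smul_eq_mul]
    · intro j _ hj
      rw [A.map_update_smul, A.map_update_self v hj.symm, smul_zero]
    · exact fun h => absurd (Finset.mem_univ i) h
  rw [hu0 _ i (Function.update_self i u v)] at h3
  exact hv (by rw [(mul_eq_zero.1 h3.symm).resolve_left hi, mul_zero])

end Wedge

/-! ### Hyperbolic families and positivity of the top wedge -/

section Wedge

variable {V : Type*} [AddCommGroup V] [Module ℝ V]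

/-- The radical of the restriction of `om` to `W`. -/
def radical (om : V [⋀^Fin 2]→ₗ[ℝ] ℝ) (W : Submodule ℝ V) : Submodule ℝ V :=
  W ⊓ W.dualAnnihilator.comap (bilin om)

theorem mem_radical {om : V [⋀^Fin 2]→ₗ[ℝ] ℝ} {W : Submodule ℝ V} {v : V} :
    v ∈ radical om W ↔ v ∈ W ∧ ∀ w ∈ W, bilin om v w = 0 := by
  rw [radical, Submodule.mem_inf, Submodule.mem_comap, Submodule.mem_dualAnnihilator]

/-- A family of `m` mutually orthogonal hyperbolic pairs. -/
def IsHyperbolicFamily (om : V [⋀^Fin 2]→ₗ[ℝ] ℝ) {m : ℕ} (e : Fin m × Fin 2 → V) : Prop :=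
  ∀ x y, bilin om (e x) (e y) = if x.1 = y.1 then ((y.2 : ℕ) : ℝ) - ((x.2 : ℕ) : ℝ) else 0

/-- Symplectic Gram–Schmidt: a pair with `om(u, w) = 1` is split off, and its complement in `W` has
dimension smaller by two and the same radical. -/
theorem exists_isHyperbolicFamily [FiniteDimensional ℝ V] (om : V [⋀^Fin 2]→ₗ[ℝ] ℝ)
    (W : Submodule ℝ V) : ∃ (m : ℕ) (e : Fin m × Fin 2 → V), (∀ x, e x ∈ W) ∧
      IsHyperbolicFamily om e ∧
      Module.finrank ℝ W = 2 * m + Module.finrank ℝ (radical om W) := by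
  induction hN : Module.finrank ℝ W using Nat.strong_induction_on generalizing W with
  | _ N ih =>
  by_cases h0 : ∀ u ∈ W, ∀ w ∈ W, bilin om u w = 0
  · refine ⟨0, fun x => x.1.elim0, fun x => x.1.elim0, fun x => x.1.elim0, ?_⟩
    rw [← hN, show radical om W = W from ?_]
    · simp
    · ext v
      rw [mem_radical]
      exact ⟨fun h => h.1, fun h => ⟨h, h0 v h⟩⟩
  push Not at h0
  obtain ⟨u, hu, w', hw', huw'⟩ := h0
  obtain ⟨w, hw, huw⟩ : ∃ w ∈ W, bilin om u w = 1 :=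
    ⟨(bilin om u w')⁻¹ • w', W.smul_mem _ hw', by
      rw [map_smul, smul_eq_mul, inv_mul_cancel₀ huw']⟩
  have hwu : bilin om w u = -1 := by rw [bilin_swap, huw]
  let φ : W →ₗ[ℝ] ℝ × ℝ := ((bilin om u).prod (bilin om w)) ∘ₗ W.subtype
  have hφ : Function.Surjective φ := by
    rintro ⟨a, c⟩
    refine ⟨⟨a • w - c • u, W.sub_mem (W.smul_mem _ hw) (W.smul_mem _ hu)⟩, ?_⟩
    simp [φ, bilin_self, huw, hwu]
  let W' : Submodule ℝ V := (LinearMap.ker φ).map W.subtype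
  have hW' : ∀ v, v ∈ W' ↔ v ∈ W ∧ bilin om u v = 0 ∧ bilin om w v = 0 := by
    intro v
    constructor
    · rintro ⟨x, hx, rfl⟩
      have h1 : (bilin om u x, bilin om w x) = ((0 : ℝ), (0 : ℝ)) := hx
      exact ⟨x.2, (Prod.ext_iff.1 h1).1, (Prod.ext_iff.1 h1).2⟩
    · rintro ⟨h1, h2, h3⟩
      exact ⟨⟨v, h1⟩, show (bilin om u v, bilin om w v) = ((0 : ℝ), (0 : ℝ)) by rw [h2, h3], rfl⟩
  have hdim : Module.finrank ℝ W' + 2 = N := by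
    have h1 := LinearMap.finrank_range_add_finrank_ker φ
    rw [LinearMap.range_eq_top.2 hφ, finrank_top, Module.finrank_prod, Module.finrank_self] at h1
    have h2 : Module.finrank ℝ W' = Module.finrank ℝ (LinearMap.ker φ) :=
      Submodule.finrank_map_subtype_eq W (LinearMap.ker φ)
    omega
  obtain ⟨m, e, heW, he, hm⟩ := ih _ (by omega) W' rfl
  have hrad : radical om W' = radical om W := by
    ext v
    rw [mem_radical, mem_radical, hW']
    constructor
    · rintro ⟨⟨hv, h1, h2⟩, h3⟩
      refine ⟨hv, fun y hy => ?_⟩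
      -- The projection of `y` to `W'` along `u` and `w`; `v` is orthogonal to both, so nothing is
      -- lost.
      have := h3 (y - bilin om u y • w + bilin om w y • u) ((hW' _).2
        ⟨W.add_mem (W.sub_mem hy (W.smul_mem _ hw)) (W.smul_mem _ hu), by
          simp [bilin_self, huw], by simp [bilin_self, hwu]⟩)
      rw [map_add, map_sub, map_smul, map_smul, bilin_swap om v w, bilin_swap om v u, h1,
        h2] at this
      simpa using this
    · rintro ⟨hv, h3⟩
      refine ⟨⟨hv, ?_, ?_⟩, fun y hy => h3 y ((hW' y).1 hy).1⟩
      · rw [bilin_swap, h3 u hu, neg_zero]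
      · rw [bilin_swap, h3 w hw, neg_zero]
  refine ⟨m + 1, fun x => Fin.cases (![u, w] x.2) (fun j => e (j, x.2)) x.1, ?_, ?_, ?_⟩
  · rintro ⟨j, a⟩
    refine Fin.cases ?_ (fun j => ?_) j
    · fin_cases a
      · exact hu
      · exact hw
    · exact ((hW' _).1 (heW (j, a))).1
  · rintro ⟨j, a⟩ ⟨k, c⟩
    have h1 : ∀ x, bilin om u (e x) = 0 ∧ bilin om w (e x) = 0 := fun x => ((hW' _).1 (heW x)).2
    have h2 : ∀ x, bilin om (e x) u = 0 ∧ bilin om (e x) w = 0 := fun x => by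
      rw [bilin_swap om _ u, bilin_swap om _ w, (h1 x).1, (h1 x).2]; simp
    refine Fin.cases ?_ (fun j => ?_) j <;> refine Fin.cases ?_ (fun k => ?_) k
    · fin_cases a <;> fin_cases c <;> simp [bilin_self, huw, hwu]
    · fin_cases a <;> simp [(h1 _).1, (h1 _).2, (Fin.succ_ne_zero _).symm]
    · fin_cases c <;> simp [(h2 _).1, (h2 _).2, Fin.succ_ne_zero]
    · simpa using he (j, a) (k, c)
  · rw [← hrad]; omega

/-- A nonzero term requires `τ` to permute the pairs by some `ρ` and to act inside pair `j` by some
`s j`. Since `ρ` acts on two copies, its sign cancels: both the sign of `τ` and the product equal `∏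
sign (s j)`, so the term is a square. -/
theorem sign_mul_prod_nonneg {m : ℕ} (τ : Equiv.Perm (Fin m × Fin 2)) :
    0 ≤ ((Equiv.Perm.sign τ : ℤ) : ℝ) * ∏ j : Fin m,
      (if (τ (j, 0)).1 = (τ (j, 1)).1 then (((τ (j, 1)).2 : ℕ) : ℝ) - (((τ (j, 0)).2 : ℕ) : ℝ)
        else 0) := by
  by_cases h : ∀ j, (τ (j, 0)).1 = (τ (j, 1)).1
  swap
  · push Not at h
    obtain ⟨j, hj⟩ := h
    rw [Finset.prod_eq_zero (Finset.mem_univ j) (if_neg hj), mul_zero]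
  have h' : ∀ x, (τ x).1 = (τ (x.1, 0)).1 := by
    rintro ⟨j, a⟩
    fin_cases a
    · rfl
    · exact (h j).symm
  have hsurj : Function.Surjective fun j => (τ (j, 0)).1 := fun k => by
    obtain ⟨x, hx⟩ := τ.surjective (k, 0)
    exact ⟨x.1, by simp [← h' x, hx]⟩
  let ρ : Equiv.Perm (Fin m) := Equiv.ofBijective _ (Finite.surjective_iff_bijective.1 hsurj)
  have hρ : ∀ x, (τ x).1 = ρ x.1 := h'
  have hinj : ∀ j, Function.Injective fun a => (τ (j, a)).2 := fun j a c hac => by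
    have : τ (j, a) = τ (j, c) := Prod.ext ((hρ _).trans (hρ (j, c)).symm) hac
    exact (Prod.ext_iff.1 (τ.injective this)).2
  let s : Fin m → Equiv.Perm (Fin 2) := fun j =>
    Equiv.ofBijective _ (Finite.injective_iff_bijective.1 (hinj j))
  have hs : ∀ j a, (τ (j, a)).2 = s j a := fun _ _ => rfl
  have hτ : τ = Equiv.prodCongrLeft (fun _ : Fin 2 => ρ) * Equiv.prodCongrRight s := by
    ext ⟨j, a⟩ : 1
    exact Prod.ext (hρ _) (hs _ _)
  have hJ : ∀ p : Equiv.Perm (Fin 2), (((p 1 : Fin 2) : ℕ) : ℤ) - ((p 0 : Fin 2) : ℕ) =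
      (Equiv.Perm.sign p : ℤ) := by decide
  have hsgn : (Equiv.Perm.sign τ : ℤ) = ∏ j, (Equiv.Perm.sign (s j) : ℤ) := by
    rw [hτ, Equiv.Perm.sign_mul, Equiv.Perm.sign_prodCongrLeft, Equiv.Perm.sign_prodCongrRight]
    simp
  have hprod : ∏ j : Fin m,
      (if (τ (j, 0)).1 = (τ (j, 1)).1 then (((τ (j, 1)).2 : ℕ) : ℝ) - (((τ (j, 0)).2 : ℕ) : ℝ)
        else 0) = ((∏ j, (Equiv.Perm.sign (s j) : ℤ) : ℤ) : ℝ) := by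
    rw [Int.cast_prod]
    refine Finset.prod_congr rfl fun j _ => ?_
    rw [if_pos (h j), ← hJ (s j), hs, hs]
    push_cast
    rfl
  rw [hprod, hsgn]
  exact mul_self_nonneg _

/-- The indexing of the vectors in `wedgeTop`. -/
def wedgeIndex (n : ℕ) : Fin (2 * n + 1) ≃ Option (Fin n × Fin 2) :=
  (finCongr (by rw [mul_comm])).trans
    ((finSuccEquiv (n * 2)).trans (Equiv.optionCongr finProdFinEquiv.symm))

theorem wedgeIndex_zero (n : ℕ) : wedgeIndex n 0 = none := by
  simp [wedgeIndex]

theorem wedgeIndex_symm_some (n : ℕ) (j : Fin n) (a : Fin 2) :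
    ((wedgeIndex n).symm (some (j, a)) : ℕ) = 2 * j + a + 1 := by
  simp [wedgeIndex]; ring

/-- Evaluated on `R` and the hyperbolic pairs, the sum over permutations has no negative term, and
the identity contributes `1`; no exact count is needed. -/
theorem wedgeTop_ne_zero {n : ℕ} {om : V [⋀^Fin 2]→ₗ[ℝ] ℝ} {lam : V [⋀^Fin 1]→ₗ[ℝ] ℝ} {R : V}
    (hR : covector lam R = 1) {e : Fin n × Fin 2 → V} (he : IsHyperbolicFamily om e)
    (hl : ∀ x, covector lam (e x) = 0) : ∃ v, wedgeTop n om lam v ≠ 0 := by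
  let w : Option (Fin n × Fin 2) → V := fun o => o.elim R e
  let T : Equiv.Perm (Option (Fin n × Fin 2)) → ℝ := fun τ =>
    ((Equiv.Perm.sign τ : ℤ) : ℝ) * (covector lam (w (τ none)) * ∏ j : Fin n,
      bilin om (w (τ (some (j, 0)))) (w (τ (some (j, 1)))))
  have hsum : wedgeTop n om lam (w ∘ wedgeIndex n) = ((2 : ℝ) ^ n)⁻¹ * ∑ τ, T τ := by
    rw [wedgeTop]
    congr 1
    refine Fintype.sum_equiv (wedgeIndex n).permCongr _ _ fun σ => ?_
    have h0 : (wedgeIndex n).symm none = 0 := by rw [Equiv.symm_apply_eq, wedgeIndex_zero]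
    have h1 : ∀ j : Fin n, (wedgeIndex n).symm (some (j, 0)) = ⟨2 * j + 1, by omega⟩ := fun j =>
      Fin.ext (by rw [wedgeIndex_symm_some]; simp)
    have h2 : ∀ j : Fin n, (wedgeIndex n).symm (some (j, 1)) = ⟨2 * j + 2, by omega⟩ := fun j =>
      Fin.ext (by rw [wedgeIndex_symm_some]; simp)
    simp only [T, Equiv.Perm.sign_permCongr, Equiv.permCongr_apply, h0, h1, h2, covector_apply,
      bilin_apply, Function.comp_apply]
  have hT : ∀ τ, 0 ≤ T τ := by
    intro τ
    -- The index `none` carries `R`. If `τ` moves it, `lam` is applied to a hyperbolic vector and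
    -- the term vanishes.
    by_cases h0 : τ none = none
    · have h1 : τ = Equiv.optionCongr (Equiv.removeNone τ) := by
        ext1 x
        cases x with
        | none => simpa using h0
        | some x =>
          rw [Equiv.optionCongr_apply, Option.map_some]
          refine (Equiv.removeNone_some τ ?_).symm
          exact Option.ne_none_iff_exists'.1 fun h1 => by
            simpa using τ.injective (h1.trans h0.symm)
      generalize Equiv.removeNone τ = τ' at h1
      subst h1
      have := sign_mul_prod_nonneg τ'
      simpa [T, w, hR, he _ _] using this
    · obtain ⟨x, hx⟩ := Option.ne_none_iff_exists'.1 h0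
      simp [T, hx, w, hl]
  have h1 : T 1 = 1 := by
    simp [T, w, hR, he _ _]
  refine ⟨w ∘ wedgeIndex n, ?_⟩
  rw [hsum]
  have : 0 < ∑ τ, T τ := Finset.sum_pos' (fun τ _ => hT τ)
    ⟨1, Finset.mem_univ _, by rw [h1]; norm_num⟩
  positivity

end Wedge

/-! ### Linear coisotropic reduction -/

section Reduction

variable {V : Type*} [AddCommGroup V] [Module ℝ V] [FiniteDimensional ℝ V]
  {om : V [⋀^Fin 2]→ₗ[ℝ] ℝ} {lam : V [⋀^Fin 1]→ₗ[ℝ] ℝ}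

/-- By parity: the dimension is odd and a hyperbolic family is even, so `om` has a nonzero radical
vector. It lies outside `ker lam` and can be normalised. -/
theorem exists_isReebVector {n : ℕ} (hn : Module.finrank ℝ V = 2 * n + 1)
    {v : Fin (2 * n + 1) → V} (hv : wedgeTop n om lam v ≠ 0) : ∃ R, IsReebVector om lam R := by
  have h0 := eq_zero_of_wedgeTop_ne_zero hn hv
  obtain ⟨m, e, -, -, hm⟩ := exists_isHyperbolicFamily om ⊤
  rw [finrank_top, hn] at hm
  have h1 : radical om ⊤ ≠ ⊥ := fun h => by
    rw [h, finrank_bot] at hm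
    omega
  obtain ⟨u, hu, hu0⟩ := (Submodule.ne_bot_iff _).1 h1
  have hu1 : bilin om u = 0 := by
    ext w
    exact (mem_radical.1 hu).2 w trivial
  have hu2 : covector lam u ≠ 0 := fun h => hu0 (h0 u hu1 h)
  refine ⟨(covector lam u)⁻¹ • u, ?_, ?_, h0⟩
  · rw [map_smul, hu1, smul_zero]
  · rw [map_smul, smul_eq_mul, inv_mul_cancel₀ hu2]

theorem finrank_inf_horizontal {T : Submodule ℝ V} (hT : ¬ T ≤ horizontal lam) :
    Module.finrank ℝ ↥(T ⊓ horizontal lam) + 1 = Module.finrank ℝ T := by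
  let φ : T →ₗ[ℝ] ℝ := covector lam ∘ₗ T.subtype
  have h1 := LinearMap.finrank_range_add_finrank_ker φ
  have h2 : LinearMap.range φ = ⊤ := by
    rw [LinearMap.range_eq_top]
    obtain ⟨t, ht, ht0⟩ := SetLike.not_le_iff_exists.1 hT
    rw [mem_horizontal] at ht0
    intro c
    refine ⟨(c / covector lam t) • ⟨t, ht⟩, ?_⟩
    simp [φ, div_mul_cancel₀ c ht0]
  have h3 : T ⊓ horizontal lam = (LinearMap.ker φ).map T.subtype := by
    ext v
    constructor
    · rintro ⟨hv, hv0⟩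
      exact ⟨⟨v, hv⟩, mem_horizontal.1 hv0, rfl⟩
    · rintro ⟨x, hx, rfl⟩
      exact ⟨x.2, mem_horizontal.2 hx⟩
  rw [h3, Submodule.finrank_map_subtype_eq, ← h1, h2, finrank_top, Module.finrank_self]
  ring

omit [FiniteDimensional ℝ V] in
theorem IsReebVector.not_le_horizontal {R : V} (h : IsReebVector om lam R) {T : Submodule ℝ V}
    (hT : R ∈ T) : ¬ T ≤ horizontal lam := fun hle => by
  have := mem_horizontal.1 (hle hT)
  rw [h.covector_eq] at this
  exact one_ne_zero this

/-- The converse of `exists_isReebVector`: `om` has no radical on `ker lam`, so a hyperbolic family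
has the full dimension of `ker lam`, and `R` completes it. -/
theorem IsReebVector.exists_wedgeTop_ne_zero {R : V} (h : IsReebVector om lam R) :
    ∃ n, Module.finrank ℝ V = 2 * n + 1 ∧ ∃ v, wedgeTop n om lam v ≠ 0 := by
  obtain ⟨m, e, heH, he, hm⟩ := exists_isHyperbolicFamily om (horizontal lam)
  have h1 : radical om (horizontal lam) = ⊥ := by
    refine (Submodule.eq_bot_iff _).2 fun v hv => ?_
    obtain ⟨hv0, hv1⟩ := mem_radical.1 hv
    refine h.eq_zero v ?_ (mem_horizontal.1 hv0)
    ext w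
    have := hv1 (w - covector lam w • R) (mem_horizontal.2 (by simp [h.covector_eq]))
    rw [map_sub, map_smul, h.bilin_right, smul_zero, sub_zero] at this
    simpa using this
  rw [h1, finrank_bot] at hm
  have h2 := finrank_inf_horizontal (T := ⊤) (h.not_le_horizontal trivial)
  rw [top_inf_eq, finrank_top] at h2
  exact ⟨m, by omega, wedgeTop_ne_zero h.covector_eq he fun x => mem_horizontal.1 (heH x)⟩

/-- Linear model of coisotropic reduction: a vertical coisotropic subspace `ι : U → V` and its
reduced space `ρ : U → V'`. -/
structure IsLinearReduction {U V' : Type*} [AddCommGroup U] [Module ℝ U] [AddCommGroup V']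
    [Module ℝ V'] (om : V [⋀^Fin 2]→ₗ[ℝ] ℝ) (lam : V [⋀^Fin 1]→ₗ[ℝ] ℝ) (om' : V' [⋀^Fin 2]→ₗ[ℝ] ℝ)
    (lam' : V' [⋀^Fin 1]→ₗ[ℝ] ℝ) (ι : U →ₗ[ℝ] V) (ρ : U →ₗ[ℝ] V') : Prop where
  injective : Function.Injective ι
  surjective : Function.Surjective ρ
  bilin_eq : ∀ u w, bilin om' (ρ u) (ρ w) = bilin om (ι u) (ι w)
  covector_eq : ∀ u, covector lam' (ρ u) = covector lam (ι u)
  coisotropic : orth om lam (LinearMap.range ι) ≤ LinearMap.range ι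

namespace IsLinearReduction

variable {U V' : Type*} [AddCommGroup U] [Module ℝ U] [AddCommGroup V'] [Module ℝ V']
  [FiniteDimensional ℝ U] [FiniteDimensional ℝ V']
  {om' : V' [⋀^Fin 2]→ₗ[ℝ] ℝ} {lam' : V' [⋀^Fin 1]→ₗ[ℝ] ℝ} {ι : U →ₗ[ℝ] V} {ρ : U →ₗ[ℝ] V'}
  {R : V} {R' : V'} {L : Submodule ℝ V}

omit [FiniteDimensional ℝ U] [FiniteDimensional ℝ V'] in
-- The kernel of the reduction is `C^⊥` for `C = range ι`. Nondegeneracy of the reduced pair is what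
-- forces `ρ u = 0`; as `R ∈ C`, orthogonality to `C ∩ ker lam` extends to all of `C`.
theorem map_eq_zero_iff (hr : IsLinearReduction om lam om' lam' ι ρ) (h : IsReebVector om lam R)
    (h' : IsReebVector om' lam' R') (hR : R ∈ LinearMap.range ι) (u : U) :
    ρ u = 0 ↔ ι u ∈ orth om lam (LinearMap.range ι) := by
  rw [h.mem_orth]
  constructor
  · intro hu
    refine ⟨by rw [← hr.covector_eq, hu, map_zero], ?_⟩
    rintro _ ⟨x, rfl⟩ -
    rw [← hr.bilin_eq, hu]
    simp
  · rintro ⟨h1, h2⟩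
    refine h'.eq_zero _ ?_ (by rw [hr.covector_eq, h1])
    ext w
    obtain ⟨x, rfl⟩ := hr.surjective w
    rw [hr.bilin_eq]
    have := h2 (ι x - covector lam (ι x) • R)
      (Submodule.sub_mem _ ⟨x, rfl⟩ (Submodule.smul_mem _ _ hR)) (by simp [h.covector_eq])
    rw [map_sub, map_smul, h.bilin_right, smul_zero, sub_zero] at this
    simpa using this

omit [FiniteDimensional ℝ U] in
-- Lagrangians reduce to Lagrangians. A vector orthogonal to the image lifts to `(L ∩ C)^⊥ = (L ∩
-- ker lam) + C^⊥`; the second summand lies in `C` and dies under `ρ`.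
theorem orth_map_comap (hr : IsLinearReduction om lam om' lam' ι ρ) (h : IsReebVector om lam R)
    (h' : IsReebVector om' lam' R') (hR : R ∈ LinearMap.range ι)
    (hL : orth om lam L = L ⊓ horizontal lam) :
    orth om' lam' ((L.comap ι).map ρ) = (L.comap ι).map ρ ⊓ horizontal lam' := by
  ext v
  rw [h'.mem_orth, Submodule.mem_inf, mem_horizontal, and_comm]
  refine and_congr_left fun hv => ⟨fun hw => ?_, ?_⟩
  · obtain ⟨u, rfl⟩ := hr.surjective v
    have hu : ι u ∈ orth om lam (L ⊓ LinearMap.range ι) := by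
      refine h.mem_orth.2 ⟨by rw [← hr.covector_eq, hv], ?_⟩
      rintro _ ⟨hxL, x, rfl⟩ hx0
      rw [← hr.bilin_eq]
      exact hw _ ⟨x, hxL, rfl⟩ (by rw [hr.covector_eq, hx0])
    rw [h.orth_inf_of_lagrangian hL] at hu
    obtain ⟨a, ha, c, hc, hac⟩ := Submodule.mem_sup.1 hu
    obtain ⟨c', rfl⟩ := hr.coisotropic hc
    refine ⟨u - c', ?_, ?_⟩
    · rw [SetLike.mem_coe, Submodule.mem_comap, map_sub, ← hac, add_sub_cancel_right]
      exact ha.1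
    · rw [map_sub, (hr.map_eq_zero_iff h h' hR c').2 hc, sub_zero]
  · rintro ⟨u, hu, rfl⟩ _ ⟨x, hx, rfl⟩ hx0
    rw [hr.bilin_eq]
    rw [hr.covector_eq] at hv hx0
    have h1 : ι u ∈ orth om lam L := by
      rw [hL]
      exact ⟨hu, mem_horizontal.2 hv⟩
    exact (h.mem_orth.1 h1).2 _ hx hx0

omit [FiniteDimensional ℝ V'] in
-- Rank–nullity for `ρ` on `L ∩ C`, whose kernel is `L ∩ C^⊥`. Besides fixed dimensions, only `dim
-- (C ∩ L)` and `dim (C ∩ L ∩ ker lam)` enter; this is the source of the constant rank of `π` on `L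
-- ∩ N`.
theorem finrank_map_comap (hr : IsLinearReduction om lam om' lam' ι ρ)
    (h : IsReebVector om lam R) (h' : IsReebVector om' lam' R') (hR : R ∈ LinearMap.range ι)
    (hL : orth om lam L = L ⊓ horizontal lam) :
    2 * (Module.finrank ℝ ((L.comap ι).map ρ) +
        Module.finrank ℝ ↥(LinearMap.range ι ⊓ L ⊓ horizontal lam)) + Module.finrank ℝ V + 1 =
      2 * (Module.finrank ℝ ↥(LinearMap.range ι ⊓ L) + Module.finrank ℝ U) := by
  have hcomap : ∀ T : Submodule ℝ V, Module.finrank ℝ (T.comap ι) =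
      Module.finrank ℝ ↥(LinearMap.range ι ⊓ T) := fun T => by
    rw [← Submodule.map_comap_eq]
    exact (LinearEquiv.finrank_eq (Submodule.equivMapOfInjective ι hr.injective _))
  let φ : L.comap ι →ₗ[ℝ] V' := ρ ∘ₗ (L.comap ι).subtype
  have h1 := LinearMap.finrank_range_add_finrank_ker φ
  have h2 : LinearMap.range φ = (L.comap ι).map ρ := by
    rw [LinearMap.range_comp, Submodule.range_subtype]
  have h3 : (LinearMap.ker φ).map (L.comap ι).subtype =
      (L ⊓ orth om lam (LinearMap.range ι)).comap ι := by
    ext u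
    constructor
    · rintro ⟨x, hx, rfl⟩
      exact ⟨x.2, (hr.map_eq_zero_iff h h' hR _).1 hx⟩
    · rintro ⟨hu, hu0⟩
      exact ⟨⟨u, hu⟩, (hr.map_eq_zero_iff h h' hR _).2 hu0, rfl⟩
  have h4 : Module.finrank ℝ (LinearMap.ker φ) =
      Module.finrank ℝ ↥(L ⊓ orth om lam (LinearMap.range ι)) := by
    rw [← Submodule.finrank_map_subtype_eq (L.comap ι), h3, hcomap, inf_left_comm,
      inf_eq_right.2 hr.coisotropic]
  rw [h2, h4, hcomap] at h1
  have h5 := h.finrank_inf_orth (C := LinearMap.range ι) hL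
  have h6 := h.finrank_lagrangian hL
  have h7 := finrank_inf_horizontal (h.not_le_horizontal hR)
  rw [LinearMap.finrank_range_of_inj hr.injective] at h7
  rw [inf_comm L (LinearMap.range ι)] at h5
  omega

end IsLinearReduction

end Reduction

/-! ### Images of constant-rank maps have small Hausdorff dimension -/

section ConstantRank

variable {E F G : Type*} [NormedAddCommGroup E] [NormedSpace ℝ E]
  [NormedAddCommGroup F] [NormedSpace ℝ F] [NormedAddCommGroup G] [NormedSpace ℝ G]

theorem eq_of_fderiv_vertical_eq_zero {h : E × F → G} {U : Set E} {W : Set F}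
    (hW : IsOpen W) (hWc : Convex ℝ W)
    (hd : ∀ p ∈ U ×ˢ W, DifferentiableAt ℝ h p)
    (h0 : ∀ p ∈ U ×ˢ W, ∀ v : F, fderiv ℝ h p (0, v) = 0) {y : E} (hy : y ∈ U) {z z' : F}
    (hz : z ∈ W) (hz' : z' ∈ W) : h (y, z) = h (y, z') := by
  have hder : ∀ x ∈ W, HasFDerivAt (fun x => h (y, x)) (0 : F →L[ℝ] G) x := fun x hx => by
    have h1 := (hd (y, x) ⟨hy, hx⟩).hasFDerivAt.comp x (hasFDerivAt_prodMk_right (𝕜 := ℝ) y x)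
    convert! h1 using 1
    ext v
    simpa using (h0 (y, x) ⟨hy, hx⟩ v).symm
  exact hW.is_const_of_fderiv_eq_zero hWc.isPreconnected
    (fun x hx => (hder x hx).differentiableAt.differentiableWithinAt)
    (fun x hx => (hder x hx).fderiv) hz hz'

/-- The rank theorem in the form needed: in suitable coordinates `h` depends on `r` variables only,
so locally its image is a `C¹` image of an open set of an `r`-dimensional space. -/
theorem exists_dimH_image_le_of_finrank_range_fderiv [FiniteDimensional ℝ E]
    [FiniteDimensional ℝ G] {h : E → G} {O : Set E} (hO : IsOpen O) (hh : ContDiffOn ℝ 1 h O)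
    {r : ℕ} (hr : ∀ x ∈ O, Module.finrank ℝ (LinearMap.range (fderiv ℝ h x : E →ₗ[ℝ] G)) = r)
    {x₀ : E} (hx₀ : x₀ ∈ O) : ∃ U ∈ 𝓝 x₀, dimH (h '' U) ≤ r := by
  have hc : ∀ x ∈ O, ContDiffAt ℝ 1 h x := fun x hx => hh.contDiffAt (hO.mem_nhds hx)
  have hd : ∀ x ∈ O, HasFDerivAt h (fderiv ℝ h x) x := fun x hx =>
    ((hc x hx).differentiableAt one_ne_zero).hasFDerivAt
  set T := fderiv ℝ h x₀ with hT
  set Y := LinearMap.range (T : E →ₗ[ℝ] G) with hY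
  set K := LinearMap.ker (T : E →ₗ[ℝ] G) with hK
  obtain ⟨pr, hpr⟩ : ∃ pr : G →L[ℝ] Y, ∀ y : Y, pr y = y :=
    Submodule.ClosedComplemented.of_finiteDimensional Y
  obtain ⟨κ, hκ⟩ : ∃ κ : E →L[ℝ] K, ∀ k : K, κ k = k :=
    Submodule.ClosedComplemented.of_finiteDimensional K
  have hinj : Function.Injective ((pr.comp T).prod κ) := by
    refine (injective_iff_map_eq_zero _).2 fun v hv => ?_
    have h1 : pr (T v) = 0 := (Prod.ext_iff.1 hv).1
    have h2 : κ v = 0 := (Prod.ext_iff.1 hv).2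
    have h3 : T v = 0 := by
      have := hpr ⟨T v, v, rfl⟩
      rw [h1] at this
      simpa using congrArg Subtype.val this.symm
    have := hκ ⟨v, h3⟩
    rw [h2] at this
    simpa using congrArg Subtype.val this.symm
  have hfin : Module.finrank ℝ E = Module.finrank ℝ (Y × K) := by
    rw [Module.finrank_prod, LinearMap.finrank_range_add_finrank_ker]
  let T' : E ≃L[ℝ] Y × K := (LinearEquiv.ofInjectiveOfFinrankEq
    (((pr.comp T).prod κ : E →L[ℝ] Y × K) : E →ₗ[ℝ] Y × K) hinj hfin).toContinuousLinearEquiv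
  -- The coordinates: the part of `h` along the range of `dh` at `x₀`, completed by a projection to
  -- the kernel.
  let Ψ : E → Y × K := fun x => (pr (h x), κ x)
  have hΨd : ∀ x ∈ O, HasFDerivAt Ψ ((pr.comp (fderiv ℝ h x)).prod κ) x := fun x hx =>
    (pr.hasFDerivAt.comp x (hd x hx)).prodMk κ.hasFDerivAt
  have hΨc : ContDiffAt ℝ 1 Ψ x₀ := (pr.contDiff.contDiffAt.comp x₀ (hc x₀ hx₀)).prodMk
    κ.contDiff.contDiffAt
  have hΨ' : HasFDerivAt Ψ (T' : E →L[ℝ] Y × K) x₀ := by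
    convert! hΨd x₀ hx₀ using 1
  let Θ := hΨc.toOpenPartialHomeomorph Ψ hΨ' one_ne_zero
  have hx₀Θ : x₀ ∈ Θ.source := hΨc.mem_toOpenPartialHomeomorph_source hΨ' one_ne_zero
  have hinv : ContDiffAt ℝ 1 Θ.symm (Ψ x₀) := hΨc.to_localInverse hΨ' one_ne_zero
  have hinv0 : Θ.symm (Ψ x₀) = x₀ := Θ.left_inv hx₀Θ
  have hev : ∀ᶠ p in 𝓝 (Ψ x₀), ContDiffAt ℝ 1 Θ.symm p ∧ Θ.symm p ∈ O ∧ p ∈ Θ.target :=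
    (hinv.eventually (by simp)).and ((hinv.continuousAt.eventually_mem
      (by rw [hinv0]; exact hO.mem_nhds hx₀)).and (Θ.open_target.mem_nhds (Θ.map_source hx₀Θ)))
  obtain ⟨ε, hε, hball⟩ := Metric.eventually_nhds_iff_ball.1 hev
  rw [show Ψ x₀ = (pr (h x₀), κ x₀) from rfl, ← ball_prod_same] at hball
  set U := Metric.ball (pr (h x₀)) ε with hU
  set W := Metric.ball (κ x₀) ε with hW
  have hm : ∀ p ∈ U ×ˢ W,
      HasFDerivAt (h ∘ Θ.symm) ((fderiv ℝ h (Θ.symm p)).comp (fderiv ℝ Θ.symm p)) p := fun p hp =>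
    (hd _ (hball p hp).2.1).comp p (((hball p hp).1.differentiableAt one_ne_zero).hasFDerivAt)
  have hright : ∀ p ∈ U ×ˢ W, ∀ v, (pr (fderiv ℝ h (Θ.symm p) (fderiv ℝ Θ.symm p v)),
      κ (fderiv ℝ Θ.symm p v)) = v := fun p hp v => by
    have h1 := (hΨd _ (hball p hp).2.1).comp p
      (((hball p hp).1.differentiableAt one_ne_zero).hasFDerivAt)
    have h2 : HasFDerivAt (Ψ ∘ Θ.symm) (ContinuousLinearMap.id ℝ (Y × K)) p := by
      refine (hasFDerivAt_id p).congr_of_eventuallyEq ?_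
      filter_upwards [Θ.open_target.mem_nhds (hball p hp).2.2] with q hq
      exact Θ.right_inv hq
    exact congrArg (fun A : Y × K →L[ℝ] Y × K => A v) (h1.unique h2)
  -- Near `x₀` the projection `pr` maps the range of `dh` onto `Y`, hence injectively as both have
  -- dimension `r`. In the coordinates `Ψ` the component `pr ∘ h` ignores `K`, so all of `h` does.
  have hvert : ∀ p ∈ U ×ˢ W, ∀ k : K, fderiv ℝ (h ∘ Θ.symm) p (0, k) = 0 := fun p hp k => by
    rw [(hm p hp).fderiv, ContinuousLinearMap.comp_apply]
    set A := fderiv ℝ h (Θ.symm p)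
    let φ : LinearMap.range (A : E →ₗ[ℝ] G) →ₗ[ℝ] Y :=
      (pr : G →ₗ[ℝ] Y) ∘ₗ (LinearMap.range (A : E →ₗ[ℝ] G)).subtype
    have hφ : Function.Surjective φ := fun y =>
      ⟨⟨_, fderiv ℝ Θ.symm p (y, 0), rfl⟩, (Prod.ext_iff.1 (hright p hp (y, 0))).1⟩
    have hφ' : Function.Injective φ := (LinearMap.injective_iff_surjective_of_finrank_eq_finrank
      (by rw [hr _ (hball p hp).2.1, hr x₀ hx₀])).2 hφ
    have h1 : φ ⟨_, fderiv ℝ Θ.symm p (0, k), rfl⟩ = φ 0 := by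
      rw [map_zero]
      exact (Prod.ext_iff.1 (hright p hp (0, k))).1
    exact congrArg Subtype.val (hφ' h1)
  have hmem : Ψ x₀ ∈ U ×ˢ W := ⟨Metric.mem_ball_self hε, Metric.mem_ball_self hε⟩
  refine ⟨Θ.source ∩ Ψ ⁻¹' (U ×ˢ W), Filter.inter_mem (Θ.open_source.mem_nhds hx₀Θ)
    (hΨc.continuousAt.preimage_mem_nhds ((Metric.isOpen_ball.prod Metric.isOpen_ball).mem_nhds
      hmem)), ?_⟩
  have hsub : h '' (Θ.source ∩ Ψ ⁻¹' (U ×ˢ W)) ⊆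
      (fun y => (h ∘ Θ.symm) (y, κ x₀)) '' U := by
    rintro _ ⟨x, ⟨hx, hxU⟩, rfl⟩
    refine ⟨(Ψ x).1, hxU.1, ?_⟩
    have h1 := eq_of_fderiv_vertical_eq_zero Metric.isOpen_ball (convex_ball (κ x₀) ε)
      (fun p hp => (hm p hp).differentiableAt) hvert hxU.1 hmem.2 hxU.2
    exact h1.trans (congrArg h (Θ.left_inv hx))
  have hcd : ContDiffOn ℝ 1 (fun y => (h ∘ Θ.symm) (y, κ x₀)) U := fun y hy =>
    ((hc _ (hball (y, κ x₀) ⟨hy, hmem.2⟩).2.1).comp y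
      ((hball (y, κ x₀) ⟨hy, hmem.2⟩).1.comp y
        (contDiffAt_id.prodMk contDiffAt_const))).contDiffWithinAt
  calc dimH (h '' (Θ.source ∩ Ψ ⁻¹' (U ×ˢ W)))
      ≤ dimH ((fun y => (h ∘ Θ.symm) (y, κ x₀)) '' U) := dimH_mono hsub
    _ ≤ dimH U := hcd.dimH_image_le (convex_ball _ _) Subset.rfl
    _ ≤ dimH (univ : Set Y) := dimH_mono (subset_univ _)
    _ = r := by rw [Real.dimH_univ_eq_finrank, hr x₀ hx₀]

/-- The local bound globalises by second countability, since the Hausdorff dimension of a countable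
union is the supremum. -/
theorem dimH_image_le_of_finrank_range_mfderiv [FiniteDimensional ℝ E] [FiniteDimensional ℝ G]
    {X : Type*} [TopologicalSpace X] [ChartedSpace E X] [IsManifold 𝓘(ℝ, E) ∞ X]
    [SecondCountableTopology X] {g : X → G} {W : Set X} (hW : IsOpen W)
    (hg : ContMDiffOn 𝓘(ℝ, E) 𝓘(ℝ, G) ∞ g W) {r : ℕ}
    (hr : ∀ x ∈ W, Module.finrank ℝ
      (LinearMap.range (mfderiv 𝓘(ℝ, E) 𝓘(ℝ, G) g x :
        TangentSpace 𝓘(ℝ, E) x →ₗ[ℝ] TangentSpace 𝓘(ℝ, G) (g x))) = r) :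
    dimH (g '' W) ≤ r := by
  have hloc : ∀ x ∈ W, ∃ U ∈ 𝓝[W] x, dimH (g '' U) ≤ r := by
    intro x hx
    set φ := chartAt E x with hφ
    have hφd := mdifferentiable_chart (I := 𝓘(ℝ, E)) x
    have hφ1 : IsManifold 𝓘(ℝ, E) 1 X := IsManifold.of_le (n := ∞) (by simp)
    set O := φ.target ∩ φ.symm ⁻¹' W with hO
    have hOo : IsOpen O := φ.isOpen_inter_preimage_symm hW
    have hsm : ContDiffOn ℝ ∞ (g ∘ φ.symm) O := by
      rw [← contMDiffOn_iff_contDiffOn]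
      exact hg.comp (contMDiffOn_chart_symm.mono inter_subset_left) inter_subset_right
    have hrk : ∀ y ∈ O, Module.finrank ℝ
        (LinearMap.range (fderiv ℝ (g ∘ φ.symm) y : E →ₗ[ℝ] G)) = r := by
      intro y hy
      have h1 : mfderiv 𝓘(ℝ, E) 𝓘(ℝ, G) (g ∘ φ.symm) y =
          (mfderiv 𝓘(ℝ, E) 𝓘(ℝ, G) g (φ.symm y)).comp (mfderiv 𝓘(ℝ, E) 𝓘(ℝ, E) φ.symm y) :=
        mfderiv_comp y ((hg.contMDiffAt (hW.mem_nhds hy.2)).mdifferentiableAt (by simp))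
          (hφd.mdifferentiableAt_symm hy.1)
      rw [mfderiv_eq_fderiv] at h1
      have h2 : Function.Surjective (mfderiv 𝓘(ℝ, E) 𝓘(ℝ, E) φ.symm y) :=
        hφd.symm.mfderiv_surjective hy.1
      have h3 : ∀ v, fderiv ℝ (g ∘ φ.symm) y v = mfderiv 𝓘(ℝ, E) 𝓘(ℝ, G) g (φ.symm y)
          (mfderiv 𝓘(ℝ, E) 𝓘(ℝ, E) φ.symm y v) := fun v => by rw [h1]; rfl
      rw [← hr _ hy.2]
      have h4 : LinearMap.range (fderiv ℝ (g ∘ φ.symm) y : E →ₗ[ℝ] G) =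
          LinearMap.range (mfderiv 𝓘(ℝ, E) 𝓘(ℝ, G) g (φ.symm y) :
            TangentSpace 𝓘(ℝ, E) (φ.symm y) →ₗ[ℝ] TangentSpace 𝓘(ℝ, G) (g (φ.symm y))) := by
        ext w
        constructor
        · rintro ⟨v, rfl⟩
          exact ⟨_, (h3 v).symm⟩
        · rintro ⟨v, rfl⟩
          obtain ⟨u, rfl⟩ := h2 v
          exact ⟨u, h3 u⟩
      rw [h4]
      rfl
    obtain ⟨U, hU, hdim⟩ := exists_dimH_image_le_of_finrank_range_fderiv hOo
      (hsm.of_le (by simp)) hrk (x₀ := φ x)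
      ⟨mem_chart_target E x, by simpa [hφ, φ.left_inv (mem_chart_source E x)] using hx⟩
    refine ⟨φ.source ∩ φ ⁻¹' U, mem_nhdsWithin_of_mem_nhds (Filter.inter_mem
      (φ.open_source.mem_nhds (mem_chart_source E x))
      ((φ.continuousAt (mem_chart_source E x)).preimage_mem_nhds hU)), le_trans (dimH_mono ?_) hdim⟩
    rintro _ ⟨x', ⟨h1, h2⟩, rfl⟩
    exact ⟨φ x', h2, by rw [Function.comp_apply, φ.left_inv h1]⟩
  choose! U hU hdim using hloc
  obtain ⟨t, htW, htc, ht⟩ := TopologicalSpace.countable_cover_nhdsWithin hU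
  calc dimH (g '' W) ≤ dimH (⋃ x ∈ t, g '' U x) := by
        refine dimH_mono ((image_mono ht).trans ?_)
        rw [image_iUnion₂]
    _ ≤ r := by
        rw [dimH_bUnion htc]
        exact iSup₂_le fun x hx => hdim x (htW hx)

end ConstantRank

/-! ### Normal forms of immersions and submersions -/

section Charts

variable {E E' : Type*} [NormedAddCommGroup E] [NormedSpace ℝ E]
  [NormedAddCommGroup E'] [NormedSpace ℝ E']
  {N : Type*} [TopologicalSpace N] [ChartedSpace E N]
  {B : Type*} [TopologicalSpace B] [ChartedSpace E' B]

theorem mdifferentiable_of_contMDiffOn {φ : OpenPartialHomeomorph N E'}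
    (h : ContMDiffOn 𝓘(ℝ, E) 𝓘(ℝ, E') ∞ φ φ.source)
    (h' : ContMDiffOn 𝓘(ℝ, E') 𝓘(ℝ, E) ∞ φ.symm φ.target) :
    φ.MDifferentiable 𝓘(ℝ, E) 𝓘(ℝ, E') :=
  ⟨h.mdifferentiableOn (by simp), h'.mdifferentiableOn (by simp)⟩

theorem mdifferentiable_of_mem_maximalAtlas {φ : OpenPartialHomeomorph N E}
    (h : φ ∈ IsManifold.maximalAtlas 𝓘(ℝ, E) ∞ N) : φ.MDifferentiable 𝓘(ℝ, E) 𝓘(ℝ, E) :=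
  mdifferentiable_of_contMDiffOn (contMDiffOn_of_mem_maximalAtlas h)
    (contMDiffOn_symm_of_mem_maximalAtlas h)

theorem mfderiv_injective_of_isImmersionAt {f : N → B} {q : N}
    (h : IsImmersionAt 𝓘(ℝ, E) 𝓘(ℝ, E') ∞ f q) :
    Function.Injective (mfderiv 𝓘(ℝ, E) 𝓘(ℝ, E') f q) := by
  -- A local left inverse of `f` up to charts: in the normal form `f` is the inclusion of the first
  -- factor, so `r ∘ f` is a chart.
  let r : B → E := fun y => (h.equiv.symm (h.codChart y)).1
  have hsm : MDifferentiableAt 𝓘(ℝ, E) 𝓘(ℝ, E') f q := h.contMDiffAt.mdifferentiableAt (by simp)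
  have hr : MDifferentiableAt 𝓘(ℝ, E') 𝓘(ℝ, E) r (f q) := by
    have h1 : ContDiff ℝ ∞ fun y => (h.equiv.symm y).1 :=
      contDiff_fst.comp h.equiv.symm.contDiff
    exact (h1.contMDiff.contMDiffAt.comp (f q) (contMDiffAt_of_mem_maximalAtlas
      h.codChart_mem_maximalAtlas h.mem_codChart_source)).mdifferentiableAt (by simp)
  have hrf : r ∘ f =ᶠ[𝓝 q] h.domChart := by
    filter_upwards [h.domChart.open_source.mem_nhds h.mem_domChart_source] with q' hq'
    have h1 := h.writtenInCharts (show h.domChart q' ∈ (h.domChart.extend 𝓘(ℝ, E)).target by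
      simpa using h.domChart.map_source hq')
    simp only [Function.comp_apply, OpenPartialHomeomorph.extend_coe,
      OpenPartialHomeomorph.extend_coe_symm, modelWithCornersSelf_coe,
      modelWithCornersSelf_coe_symm, id_eq, h.domChart.left_inv hq'] at h1
    simp [r, h1]
  have h2 := mfderiv_comp q hr hsm
  rw [hrf.mfderiv_eq] at h2
  have h3 := (mdifferentiable_of_mem_maximalAtlas h.domChart_mem_maximalAtlas).mfderiv_injective
    h.mem_domChart_source
  rw [h2] at h3
  exact Function.Injective.of_comp (f := mfderiv 𝓘(ℝ, E') 𝓘(ℝ, E) r (f q)) h3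

/-- Charts `toChart` at `q₀` and `base` at `π q₀` in which `π` is the projection of a box
`dom ×ˢ fib` onto its first factor. -/
structure SubmersionBox (F : Type*) [NormedAddCommGroup F] [NormedSpace ℝ F] (π : N → B)
    (q₀ : N) where
  toChart : OpenPartialHomeomorph N (E' × F)
  base : OpenPartialHomeomorph B E'
  dom : Set E'
  fib : Set F
  mem_source : q₀ ∈ toChart.source
  contMDiffOn : ContMDiffOn 𝓘(ℝ, E) 𝓘(ℝ, E' × F) ∞ toChart toChart.source
  contMDiffOn_symm : ContMDiffOn 𝓘(ℝ, E' × F) 𝓘(ℝ, E) ∞ toChart.symm toChart.target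
  base_mem : base ∈ IsManifold.maximalAtlas 𝓘(ℝ, E') ∞ B
  isOpen_dom : IsOpen dom
  isOpen_fib : IsOpen fib
  convex_fib : Convex ℝ fib
  target_eq : toChart.target = dom ×ˢ fib
  mapsTo : MapsTo π toChart.source base.source
  fst_eq : ∀ q ∈ toChart.source, (toChart q).1 = base (π q)

/-- The chart of the normal form is shrunk to a product of balls, so that the fibre part is convex
and constancy along it can be read off from derivatives. -/
theorem exists_submersionBox {F : Type*} [NormedAddCommGroup F] [NormedSpace ℝ F] {π : N → B}
    {q₀ : N} (h : IsSubmersionAtOfComplement F 𝓘(ℝ, E) 𝓘(ℝ, E') ∞ π q₀) :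
    Nonempty (SubmersionBox (E := E) (E' := E') F π q₀) := by
  let Θ₀ : OpenPartialHomeomorph N (E' × F) := h.domChart.transHomeomorph h.equiv.toHomeomorph
  have hq₀ : q₀ ∈ Θ₀.source := h.mem_domChart_source
  have hco : h.codChart.target ∈ 𝓝 (Θ₀ q₀).1 := by
    refine h.codChart.open_target.mem_nhds ?_
    have h1 := h.target_subset_preimage_target
      (show h.domChart q₀ ∈ (h.domChart.extend 𝓘(ℝ, E)).target by
        simpa using h.domChart.map_source h.mem_domChart_source)
    change (h.equiv (h.domChart q₀)).1 ∈ h.codChart.target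
    simpa using h1
  have hn : Θ₀.target ∩ (h.codChart.target ×ˢ univ) ∈ 𝓝 (Θ₀ q₀) :=
    Filter.inter_mem (Θ₀.open_target.mem_nhds (Θ₀.map_source hq₀))
      (prod_mem_nhds hco Filter.univ_mem)
  obtain ⟨ε, hε, hball⟩ := Metric.mem_nhds_iff.1 hn
  set U := Metric.ball (Θ₀ q₀).1 ε with hU
  set W := Metric.ball (Θ₀ q₀).2 ε with hW
  have hUW : Metric.ball (Θ₀ q₀) ε = U ×ˢ W := (ball_prod_same _ _ _).symm
  rw [hUW] at hball
  have hmem : Θ₀ q₀ ∈ U ×ˢ W := ⟨Metric.mem_ball_self hε, Metric.mem_ball_self hε⟩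
  let Θ := (Θ₀.symm.restrOpen (U ×ˢ W) (Metric.isOpen_ball.prod Metric.isOpen_ball)).symm
  have htgt : Θ.target = U ×ˢ W :=
    inter_eq_right.2 fun p hp => (hball hp).1
  have hsrc : Θ.source ⊆ h.domChart.source := fun q hq => hq.1
  have hΘ : ∀ q, Θ q = h.equiv (h.domChart q) := fun _ => rfl
  have hΘs : ∀ p, Θ.symm p = h.domChart.symm (h.equiv.symm p) := fun _ => rfl
  refine ⟨⟨Θ, h.codChart, U, W, ?_, ?_, ?_, h.codChart_mem_maximalAtlas, Metric.isOpen_ball,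
    Metric.isOpen_ball, convex_ball _ _, htgt, ?_, ?_⟩⟩
  · refine ⟨hq₀, ?_⟩
    change Θ₀.symm.symm q₀ ∈ U ×ˢ W
    exact hmem
  · exact h.equiv.contDiff.contMDiff.comp_contMDiffOn
      ((contMDiffOn_of_mem_maximalAtlas h.domChart_mem_maximalAtlas).mono hsrc)
  · refine (contMDiffOn_symm_of_mem_maximalAtlas h.domChart_mem_maximalAtlas).comp
      h.equiv.symm.contDiff.contMDiff.contMDiffOn fun p hp => ?_
    rw [htgt] at hp
    exact (hball hp).1
  · exact fun q hq => h.mapsto_domChart_source_codChart_source (hsrc hq)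
  · intro q hq
    have h1 := h.writtenInCharts (show h.domChart q ∈ (h.domChart.extend 𝓘(ℝ, E)).target by
      simpa using h.domChart.map_source (hsrc hq))
    simp only [Function.comp_apply, OpenPartialHomeomorph.extend_coe,
      OpenPartialHomeomorph.extend_coe_symm, modelWithCornersSelf_coe,
      modelWithCornersSelf_coe_symm, id_eq, h.domChart.left_inv (hsrc hq)] at h1
    rw [hΘ]
    exact h1.symm

namespace SubmersionBox

variable {F : Type*} [NormedAddCommGroup F] [NormedSpace ℝ F] {π : N → B} {q₀ : N}

variable (b : SubmersionBox (E := E) (E' := E') F π q₀)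

theorem proj_symm {p : E' × F} (hp : p ∈ b.toChart.target) :
    π (b.toChart.symm p) = b.base.symm p.1 := by
  have h1 := b.fst_eq _ (b.toChart.map_target hp)
  rw [b.toChart.right_inv hp] at h1
  rw [h1, b.base.left_inv (b.mapsTo (b.toChart.map_target hp))]

theorem mem_target {q : N} (hq : q ∈ b.toChart.source) :
    b.base (π q) ∈ b.dom ∧ (b.toChart q).2 ∈ b.fib := by
  have := b.toChart.map_source hq
  rw [b.target_eq] at this
  exact ⟨b.fst_eq q hq ▸ this.1, this.2⟩

theorem mdifferentiable : b.toChart.MDifferentiable 𝓘(ℝ, E) 𝓘(ℝ, E' × F) :=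
  mdifferentiable_of_contMDiffOn b.contMDiffOn b.contMDiffOn_symm

/-- `dπ` in the charts of a box. -/
theorem mfderiv_fst (hπ : ContMDiff 𝓘(ℝ, E) 𝓘(ℝ, E') ∞ π) {q : N} (hq : q ∈ b.toChart.source)
    (v : TangentSpace 𝓘(ℝ, E) q) :
    (mfderiv 𝓘(ℝ, E) 𝓘(ℝ, E' × F) b.toChart q v : E' × F).1 =
      mfderiv 𝓘(ℝ, E') 𝓘(ℝ, E') b.base (π q) (mfderiv 𝓘(ℝ, E) 𝓘(ℝ, E') π q v) := by
  have h1 : MDifferentiableAt 𝓘(ℝ, E) 𝓘(ℝ, E' × F) b.toChart q :=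
    b.mdifferentiable.mdifferentiableAt hq
  have h2 : MDifferentiableAt 𝓘(ℝ, E') 𝓘(ℝ, E') b.base (π q) :=
    (mdifferentiable_of_mem_maximalAtlas b.base_mem).mdifferentiableAt (b.mapsTo hq)
  have h3 : MDifferentiableAt 𝓘(ℝ, E) 𝓘(ℝ, E') π q := hπ.mdifferentiable (by simp) q
  have h4 : (fun q => (b.toChart q).1) =ᶠ[𝓝 q] b.base ∘ π := by
    filter_upwards [b.toChart.open_source.mem_nhds hq] with q' hq' using b.fst_eq q' hq'
  have h5 := h4.mfderiv_eq (I := 𝓘(ℝ, E)) (I' := 𝓘(ℝ, E'))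
  rw [mfderiv_comp q h2 h3] at h5
  have h6 : MDifferentiableAt 𝓘(ℝ, E' × F) 𝓘(ℝ, E') (Prod.fst : E' × F → E') (b.toChart q) :=
    (contDiff_fst (n := ∞)).contMDiff.mdifferentiable (by simp) _
  have h7 := mfderiv_comp q h6 h1
  have h8 : mfderiv 𝓘(ℝ, E' × F) 𝓘(ℝ, E') (Prod.fst : E' × F → E') (b.toChart q) =
      ContinuousLinearMap.fst ℝ E' F := by
    rw [mfderiv_eq_fderiv]; exact fderiv_fst
  rw [h8] at h7
  have h9 := h7.symm.trans h5
  exact congrArg (fun A : E →L[ℝ] E' => A v) h9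

/-- A smooth local section through a point of a box. -/
theorem exists_section (b : SubmersionBox (E := E) (E' := E') F π q₀) :
    ∃ (V : Set B) (σ : B → N), IsOpen V ∧ π q₀ ∈ V ∧
    ContMDiffOn 𝓘(ℝ, E') 𝓘(ℝ, E) ∞ σ V ∧ σ (π q₀) = q₀ ∧ ∀ y ∈ V, π (σ y) = y := by
  have h0 := b.mem_target b.mem_source
  -- The section keeps the fibre coordinate of `q₀` fixed.
  set z := (b.toChart q₀).2 with hz
  have hmem : ∀ y ∈ b.base.source ∩ b.base ⁻¹' b.dom, (b.base y, z) ∈ b.toChart.target :=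
    fun y hy => by rw [b.target_eq]; exact ⟨hy.2, h0.2⟩
  refine ⟨b.base.source ∩ b.base ⁻¹' b.dom, fun y => b.toChart.symm (b.base y, z),
    b.base.isOpen_inter_preimage b.isOpen_dom, ⟨b.mapsTo b.mem_source, h0.1⟩, ?_, ?_, ?_⟩
  · have h1 : ContDiff ℝ ∞ fun y : E' => (y, z) := contDiff_id.prodMk contDiff_const
    exact b.contMDiffOn_symm.comp (h1.contMDiff.comp_contMDiffOn
      ((contMDiffOn_of_mem_maximalAtlas b.base_mem).mono inter_subset_left)) hmem
  · have : (b.base (π q₀), z) = b.toChart q₀ := Prod.ext (b.fst_eq q₀ b.mem_source).symm rfl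
    change b.toChart.symm (b.base (π q₀), z) = q₀
    rw [this, b.toChart.left_inv b.mem_source]
  · intro y hy
    change π (b.toChart.symm (b.base y, z)) = y
    rw [b.proj_symm (hmem y hy), b.base.left_inv hy.1]

end SubmersionBox

theorem exists_local_section {π : N → B} (hπ : IsSubmersion 𝓘(ℝ, E) 𝓘(ℝ, E') ∞ π) (q : N) :
    ∃ (V : Set B) (σ : B → N), IsOpen V ∧ π q ∈ V ∧
    ContMDiffOn 𝓘(ℝ, E') 𝓘(ℝ, E) ∞ σ V ∧ σ (π q) = q ∧ ∀ y ∈ V, π (σ y) = y := by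
  obtain ⟨b⟩ := exists_submersionBox (hπ.isSubmersionOfComplement_complement q)
  exact b.exists_section

theorem mfderiv_comp_section {π : N → B} (hπ : ContMDiff 𝓘(ℝ, E) 𝓘(ℝ, E') ∞ π) {V : Set B}
    {σ : B → N} (hV : IsOpen V) (hσ : ContMDiffOn 𝓘(ℝ, E') 𝓘(ℝ, E) ∞ σ V)
    (hπσ : ∀ y ∈ V, π (σ y) = y) {y : B} (hy : y ∈ V) (w : TangentSpace 𝓘(ℝ, E') y) :
    mfderiv 𝓘(ℝ, E) 𝓘(ℝ, E') π (σ y) (mfderiv 𝓘(ℝ, E') 𝓘(ℝ, E) σ y w) = w := by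
  have h1 : MDifferentiableAt 𝓘(ℝ, E') 𝓘(ℝ, E) σ y :=
    (hσ.contMDiffAt (hV.mem_nhds hy)).mdifferentiableAt (by simp)
  have h2 := mfderiv_comp y (hπ.mdifferentiable (by simp) (σ y)) h1
  have h3 : π ∘ σ =ᶠ[𝓝 y] id := by
    filter_upwards [hV.mem_nhds hy] with y' hy' using hπσ y' hy'
  rw [h3.mfderiv_eq, mfderiv_id] at h2
  exact (congrArg (fun A : E' →L[ℝ] E' => A w) h2).symm

theorem mfderiv_surjective_of_isSubmersion {π : N → B}
    (hπ : IsSubmersion 𝓘(ℝ, E) 𝓘(ℝ, E') ∞ π) (q : N) :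
    Function.Surjective (mfderiv 𝓘(ℝ, E) 𝓘(ℝ, E') π q) := by
  obtain ⟨V, σ, hV, hq, hσ, hσq, hπσ⟩ := exists_local_section hπ q
  intro w
  have h := mfderiv_comp_section hπ.contMDiff hV hσ hπσ hq w
  rw [hσq] at h
  exact ⟨_, h⟩

end Charts

/-! ### Smoothness of alternating maps, and closed forms on a box -/

section AlternatingSmooth

variable {E F : Type*} [NormedAddCommGroup E] [NormedSpace ℝ E] [NormedAddCommGroup F]
  [NormedSpace ℝ F] {k : ℕ}

theorem contDiff_compContinuousLinearMap_apply {n : WithTop ℕ∞} (v : Fin k → E) :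
    ContDiff ℝ n fun p : (F [⋀^Fin k]→L[ℝ] ℝ) × (E →L[ℝ] F) =>
      p.1.compContinuousLinearMap p.2 v := by
  have h1 : ContDiff ℝ n fun p : (F [⋀^Fin k]→L[ℝ] ℝ) × (E →L[ℝ] F) =>
      ContinuousMultilinearMap.compContinuousLinearMapContinuousMultilinear ℝ
        (fun _ : Fin k => E) (fun _ => F) ℝ (fun _ => p.2) :=
    (ContinuousMultilinearMap.contDiff _).comp (contDiff_pi.2 fun _ => contDiff_snd)
  have h2 : ContDiff ℝ n fun p : (F [⋀^Fin k]→L[ℝ] ℝ) × (E →L[ℝ] F) =>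
      ContinuousAlternatingMap.toContinuousMultilinearMapCLM ℝ p.1 :=
    (ContinuousAlternatingMap.toContinuousMultilinearMapCLM ℝ :
      (F [⋀^Fin k]→L[ℝ] ℝ) →L[ℝ] _).contDiff.comp contDiff_fst
  exact (ContinuousMultilinearMap.apply ℝ (fun _ : Fin k => E) ℝ v).contDiff.comp
    (h1.clm_apply h2)

/-- Values on tuples of basis vectors determine an alternating map, so smoothness of a family can be
tested on finitely many evaluations. -/
theorem exists_leftInverse_alternating_eval [FiniteDimensional ℝ E] :
    ∃ (m : ℕ) (v : Fin m → Fin k → E) (L : (Fin m → ℝ) →L[ℝ] (E [⋀^Fin k]→L[ℝ] ℝ)),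
      ∀ f : E [⋀^Fin k]→L[ℝ] ℝ, L (fun a => f (v a)) = f := by
  let bs := Module.finBasis ℝ E
  let en := Fintype.equivFin (Fin k → Fin (Module.finrank ℝ E))
  let v : Fin (Fintype.card (Fin k → Fin (Module.finrank ℝ E))) → Fin k → E :=
    fun a j => bs (en.symm a j)
  let ev : (E [⋀^Fin k]→L[ℝ] ℝ) →ₗ[ℝ] (Fin _ → ℝ) :=
    LinearMap.pi fun a => (ContinuousAlternatingMap.apply ℝ E ℝ (v a) : _ →ₗ[ℝ] ℝ)
  have hev : LinearMap.ker ev = ⊥ := by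
    refine LinearMap.ker_eq_bot'.2 fun f hf => ?_
    refine ContinuousAlternatingMap.toAlternatingMap_injective ?_
    refine bs.ext_alternating fun w _ => ?_
    have h1 := congrFun hf (en w)
    have h2 : v (en w) = fun j => bs (w j) := by
      funext j
      simp only [v, Equiv.symm_apply_apply]
    change f (v (en w)) = 0 at h1
    rw [h2] at h1
    exact h1
  obtain ⟨L, hL⟩ := LinearMap.exists_leftInverse_of_injective ev hev
  exact ⟨_, v, L.toContinuousLinearMap, fun f => LinearMap.congr_fun hL f⟩

theorem contDiff_compContinuousLinearMap [FiniteDimensional ℝ E] {n : WithTop ℕ∞} :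
    ContDiff ℝ n fun p : (F [⋀^Fin k]→L[ℝ] ℝ) × (E →L[ℝ] F) =>
      p.1.compContinuousLinearMap p.2 := by
  obtain ⟨m, v, L, hL⟩ := exists_leftInverse_alternating_eval (E := E) (k := k)
  have h1 : ContDiff ℝ n fun p : (F [⋀^Fin k]→L[ℝ] ℝ) × (E →L[ℝ] F) =>
      L fun a => p.1.compContinuousLinearMap p.2 (v a) :=
    L.contDiff.comp (contDiff_pi.2 fun a => contDiff_compContinuousLinearMap_apply (v a))
  simpa only [hL] using h1

/-- A multilinear map that vanishes as soon as one argument lies in `K` only depends on its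
arguments modulo `K`. -/
theorem alternating_congr_mod {W : Type*} [AddCommGroup W] [Module ℝ W]
    {f : W [⋀^Fin k]→ₗ[ℝ] ℝ} {K : Submodule ℝ W} (hf : ∀ v j, v j ∈ K → f v = 0)
    {v w : Fin k → W} (h : ∀ j, v j - w j ∈ K) : f v = f w := by
  have h1 : v = w + (v - w) := by abel
  have h2 := f.toMultilinearMap.map_add_univ w (v - w)
  rw [← h1] at h2
  refine h2.trans ?_
  rw [Finset.sum_eq_single Finset.univ]
  · simp
  · intro s _ hs
    obtain ⟨j, hj⟩ : ∃ j, j ∉ s := by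
      by_contra! hc
      exact hs (Finset.eq_univ_iff_forall.2 hc)
    refine hf _ j ?_
    rw [Finset.piecewise_eq_of_notMem _ _ _ hj]
    exact h j
  · exact fun h => absurd (Finset.mem_univ _) h

/-- A closed form on a box that vanishes on vertical vectors is constant in the vertical
direction. -/
theorem eq_of_extDeriv_eq_zero_of_vertical {A : E × F → (E × F) [⋀^Fin k]→L[ℝ] ℝ} {U : Set E}
    {W : Set F} (hU : IsOpen U) (hW : IsOpen W) (hWc : Convex ℝ W)
    (hA : ContDiffOn ℝ ∞ A (U ×ˢ W)) (hd : ∀ p ∈ U ×ˢ W, extDeriv A p = 0)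
    (hv : ∀ p ∈ U ×ˢ W, ∀ (v : Fin k → E × F) (j : Fin k), (v j).1 = 0 → A p v = 0)
    {y : E} (hy : y ∈ U) {z z' : F} (hz : z ∈ W) (hz' : z' ∈ W) : A (y, z) = A (y, z') := by
  have hop : IsOpen (U ×ˢ W) := hU.prod hW
  have hdiff : ∀ p ∈ U ×ˢ W, DifferentiableAt ℝ A p := fun p hp =>
    (hA.contDiffAt (hop.mem_nhds hp)).differentiableAt (by simp)
  refine eq_of_fderiv_vertical_eq_zero hW hWc hdiff (fun p hp f => ?_) hy hz hz'
  ext v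
  -- In the expansion of `dA` on `(0, f)` followed by `v`, every term but the first differentiates a
  -- function that keeps the vertical vector as an argument of `A` and hence vanishes near `p`. What
  -- remains is the derivative of `A` along `f`.
  have h1 := extDeriv_apply (hdiff p hp) (Fin.cons ((0 : E), f) v : Fin (k + 1) → E × F)
  have hev : ∀ w : Fin k → E × F, ∀ u, fderiv ℝ (fun p => A p w) p u = fderiv ℝ A p u w := by
    intro w u
    have h2 : HasFDerivAt (fun p => A p w)
        ((ContinuousAlternatingMap.apply ℝ (E × F) ℝ w).comp (fderiv ℝ A p)) p :=
      (ContinuousAlternatingMap.apply ℝ (E × F) ℝ w).hasFDerivAt.comp p (hdiff p hp).hasFDerivAt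
    rw [h2.fderiv]
    rfl
  rw [hd p hp, Fin.sum_univ_succ] at h1
  have h3 : ∀ j : Fin k, fderiv ℝ
      (fun p => A p (j.succ.removeNth (Fin.cons ((0 : E), f) v : Fin (k + 1) → E × F))) p = 0 := by
    intro j
    have h4 : (fun p => A p (j.succ.removeNth (Fin.cons ((0 : E), f) v : Fin (k + 1) → E × F)))
        =ᶠ[𝓝 p] fun _ => 0 := by
      filter_upwards [hop.mem_nhds hp] with p' hp'
      cases k with
      | zero => exact j.elim0
      | succ k =>
        refine hv p' hp' _ 0 ?_
        rw [Fin.removeNth_apply, Fin.succ_succAbove_zero, Fin.cons_zero]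
    rw [h4.fderiv_eq]
    exact fderiv_const_apply 0
  simp only [h3] at h1
  simp only [hev] at h1
  simpa [Fin.removeNth_zero] using h1.symm

end AlternatingSmooth

/-! ### Pullback of forms to normed spaces and naturality of `d` -/

section FlatPullback

variable {d k : ℕ} {M : Type*} [TopologicalSpace M] [ChartedSpace (EuclideanSpace ℝ (Fin d)) M]
  {E : Type*} [NormedAddCommGroup E] [NormedSpace ℝ E]

/-- The pullback of a form along a map from a normed space. -/
noncomputable def Form.flatPullback (α : Form d M k) (g : E → M) (y : E) : E [⋀^Fin k]→L[ℝ] ℝ :=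
  (α (g y)).compContinuousLinearMap (mfderiv 𝓘(ℝ, E) (𝓡 d) g y)

theorem Form.apply_congr (α : Form d M k) {x x' : M} (h : x = x')
    {v w : Fin k → EuclideanSpace ℝ (Fin d)} (hv : v = w) :
    (α x : EuclideanSpace ℝ (Fin d) [⋀^Fin k]→L[ℝ] ℝ) v =
      (α x' : EuclideanSpace ℝ (Fin d) [⋀^Fin k]→L[ℝ] ℝ) w := by
  subst h hv; rfl

variable [IsManifold (𝓡 d) ∞ M] {α : Form d M k} {g : E → M} {O : Set E}

/-- Smoothness and `extD` are defined through charts; this formula turns a pullback along any `g`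
into one between normed spaces. -/
theorem Form.flatPullback_eq_inChart (hO : IsOpen O) (hg : ContMDiffOn 𝓘(ℝ, E) (𝓡 d) ∞ g O) (c : M)
    {y : E} (hy : y ∈ O) (hc : g y ∈ (extChartAt (𝓡 d) c).source) :
    α.flatPullback g y = (α.inChart c (extChartAt (𝓡 d) c (g y))).compContinuousLinearMap
      (fderiv ℝ (extChartAt (𝓡 d) c ∘ g) y) := by
  set φ := extChartAt (𝓡 d) c
  have hs : IsOpen φ.source := isOpen_extChartAt_source c
  have ht : IsOpen φ.target := isOpen_extChartAt_target c
  have hgy : ContMDiffAt 𝓘(ℝ, E) (𝓡 d) ∞ g y := hg.contMDiffAt (hO.mem_nhds hy)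
  have hφ : ContMDiffAt (𝓡 d) (𝓡 d) ∞ φ (g y) :=
    (contMDiffOn_extChartAt (I := 𝓡 d) (n := ∞) (x := c)).contMDiffAt
      ((chartAt _ c).open_source.mem_nhds (by simpa [φ] using hc))
  have hφs : MDifferentiableAt (𝓡 d) (𝓡 d) φ.symm ((φ ∘ g) y) :=
    ((contMDiffOn_extChartAt_symm (I := 𝓡 d) (n := ∞) c).contMDiffAt
      (ht.mem_nhds (φ.map_source hc))).mdifferentiableAt (by simp)
  have hφg : MDifferentiableAt 𝓘(ℝ, E) (𝓡 d) (φ ∘ g) y :=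
    (hφ.comp y hgy).mdifferentiableAt (by simp)
  have h1 : φ.symm ∘ (φ ∘ g) =ᶠ[𝓝 y] g := by
    filter_upwards [hgy.continuousAt.preimage_mem_nhds (hs.mem_nhds hc)] with y' hy'
    exact φ.left_inv hy'
  have h2 := mfderiv_comp y hφs hφg
  rw [h1.mfderiv_eq, mfderiv_eq_fderiv] at h2
  ext v
  refine α.apply_congr (φ.left_inv hc).symm ?_
  funext j
  exact congrArg (fun A : E →L[ℝ] EuclideanSpace ℝ (Fin d) => A (v j)) h2

theorem Form.contDiffOn_comp_chart (hg : ContMDiffOn 𝓘(ℝ, E) (𝓡 d) ∞ g O) (c : M) :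
    ContDiffOn ℝ ∞ (extChartAt (𝓡 d) c ∘ g) (O ∩ g ⁻¹' (extChartAt (𝓡 d) c).source) := by
  rw [← contMDiffOn_iff_contDiffOn]
  refine (contMDiffOn_extChartAt (I := 𝓡 d) (n := ∞) (x := c)).comp (hg.mono inter_subset_left)
    fun y hy => ?_
  simpa using hy.2

theorem Form.contDiffOn_flatPullback [FiniteDimensional ℝ E] (hα : α.Smooth) (hO : IsOpen O)
    (hg : ContMDiffOn 𝓘(ℝ, E) (𝓡 d) ∞ g O) : ContDiffOn ℝ ∞ (α.flatPullback g) O := by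
  intro y₀ hy₀
  set c := g y₀ with hc
  set O' := O ∩ g ⁻¹' (extChartAt (𝓡 d) c).source with hO'
  have hO'o : IsOpen O' := hg.continuousOn.isOpen_inter_preimage hO (isOpen_extChartAt_source c)
  have hh := Form.contDiffOn_comp_chart hg c
  have h1 : ContDiffOn ℝ ∞ (fun y => (α.inChart c (extChartAt (𝓡 d) c (g y)))) O' :=
    (hα c).comp hh fun y hy => (extChartAt (𝓡 d) c).map_source hy.2
  have h2 : ContDiffOn ℝ ∞ (fderiv ℝ (extChartAt (𝓡 d) c ∘ g)) O' :=
    hh.fderiv_of_isOpen hO'o (by simp)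
  have h3 : ContDiffOn ℝ ∞ (α.flatPullback g) O' :=
    (contDiff_compContinuousLinearMap.comp_contDiffOn (h1.prodMk h2)).congr fun y hy =>
      Form.flatPullback_eq_inChart hO hg c hy.1 hy.2
  exact (h3.contDiffAt (hO'o.mem_nhds ⟨hy₀, mem_extChartAt_source c⟩)).contDiffWithinAt

/-- Naturality of `d`. The chart at `g y` is chosen because it is the one that computes `extD`
there. -/
theorem Form.extDeriv_flatPullback (hα : α.Smooth) (hO : IsOpen O)
    (hg : ContMDiffOn 𝓘(ℝ, E) (𝓡 d) ∞ g O) {y : E} (hy : y ∈ O) :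
    extDeriv (α.flatPullback g) y = α.extD.flatPullback g y := by
  set c := g y with hc
  set O' := O ∩ g ⁻¹' (extChartAt (𝓡 d) c).source with hO'
  have hO'o : IsOpen O' := hg.continuousOn.isOpen_inter_preimage hO (isOpen_extChartAt_source c)
  have hyO' : y ∈ O' := ⟨hy, mem_extChartAt_source c⟩
  have hh := Form.contDiffOn_comp_chart hg c
  have h1 : α.flatPullback g =ᶠ[𝓝 y] fun y' =>
      (α.inChart c ((extChartAt (𝓡 d) c ∘ g) y')).compContinuousLinearMap
        (fderiv ℝ (extChartAt (𝓡 d) c ∘ g) y') := by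
    filter_upwards [hO'o.mem_nhds hyO'] with y' hy'
    exact Form.flatPullback_eq_inChart hO hg c hy'.1 hy'.2
  have h2 : DifferentiableAt ℝ (α.inChart c) ((extChartAt (𝓡 d) c ∘ g) y) :=
    ((hα c).contDiffAt ((isOpen_extChartAt_target c).mem_nhds
      ((extChartAt (𝓡 d) c).map_source hyO'.2))).differentiableAt (by simp)
  rw [h1.extDeriv_eq, extDeriv_pullback (r := ∞) h2 (hh.contDiffAt (hO'o.mem_nhds hyO'))
    (by simpa using ENat.LEInfty.out)]
  have h3 := mfderiv_comp y (I := 𝓘(ℝ, E)) (I' := 𝓡 d) (I'' := 𝓡 d)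
    (g := extChartAt (𝓡 d) c) (f := g)
    (((contMDiffOn_extChartAt (I := 𝓡 d) (n := ∞) (x := c)).contMDiffAt
      ((chartAt _ c).open_source.mem_nhds (mem_chart_source _ c))).mdifferentiableAt (by simp))
    ((hg.contMDiffAt (hO.mem_nhds hy)).mdifferentiableAt (by simp))
  rw [mfderiv_eq_fderiv] at h3
  rw [h3]
  rfl

end FlatPullback

/-! ### Derivatives read in the model spaces, where base points can be rewritten freely -/

section ModelDerivative

variable {E E' E'' H H' H'' : Type*} [NormedAddCommGroup E] [NormedSpace ℝ E]
  [NormedAddCommGroup E'] [NormedSpace ℝ E'] [NormedAddCommGroup E''] [NormedSpace ℝ E'']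
  [TopologicalSpace H] [TopologicalSpace H'] [TopologicalSpace H'']
  {I : ModelWithCorners ℝ E H} {I' : ModelWithCorners ℝ E' H'} {I'' : ModelWithCorners ℝ E'' H''}
  {X Y Z : Type*} [TopologicalSpace X] [ChartedSpace H X] [TopologicalSpace Y] [ChartedSpace H' Y]
  [TopologicalSpace Z] [ChartedSpace H'' Z]

/-- The derivative at `x`, with tangent vectors read in the model spaces. -/
noncomputable def modelDeriv (I : ModelWithCorners ℝ E H) (I' : ModelWithCorners ℝ E' H')
    (f : X → Y) (x : X) : E →L[ℝ] E' := mfderiv I I' f x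

theorem modelDeriv_comp {g : Y → Z} {f : X → Y} {x : X} (hg : MDifferentiableAt I' I'' g (f x))
    (hf : MDifferentiableAt I I' f x) (v : E) :
    modelDeriv I I'' (g ∘ f) x v = modelDeriv I' I'' g (f x) (modelDeriv I I' f x v) :=
  congrArg (fun A : E →L[ℝ] E'' => A v) (mfderiv_comp x hg hf)

variable {φ : OpenPartialHomeomorph X Y}

theorem modelDeriv_symm_apply (h : φ.MDifferentiable I I') {x : X} (hx : x ∈ φ.source) (v : E) :
    modelDeriv I' I φ.symm (φ x) (modelDeriv I I' φ x v) = v :=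
  congrArg (fun A : E →L[ℝ] E => A v) (h.symm_comp_deriv hx)

theorem modelDeriv_apply_symm (h : φ.MDifferentiable I I') {y : Y} (hy : y ∈ φ.target) (v : E') :
    modelDeriv I I' φ (φ.symm y) (modelDeriv I' I φ.symm y v) = v :=
  congrArg (fun A : E' →L[ℝ] E' => A v) (h.comp_symm_deriv hy)

theorem modelDeriv_injective (h : φ.MDifferentiable I I') {x : X} (hx : x ∈ φ.source) :
    Function.Injective (modelDeriv I I' φ x) := h.mfderiv_injective hx

theorem modelDeriv_surjective (h : φ.MDifferentiable I I') {x : X} (hx : x ∈ φ.source) :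
    Function.Surjective (modelDeriv I I' φ x) := h.mfderiv_surjective hx

end ModelDerivative

namespace SubmersionBox

variable {E E' F : Type*} [NormedAddCommGroup E] [NormedSpace ℝ E]
  [NormedAddCommGroup E'] [NormedSpace ℝ E'] [NormedAddCommGroup F] [NormedSpace ℝ F]
  {N : Type*} [TopologicalSpace N] [ChartedSpace E N]
  {B : Type*} [TopologicalSpace B] [ChartedSpace E' B]
  {π : N → B} {q₀ : N}

theorem modelDeriv_fst (bx : SubmersionBox (E := E) (E' := E') F π q₀)
    (hπ : ContMDiff 𝓘(ℝ, E) 𝓘(ℝ, E') ∞ π) {q : N} (hq : q ∈ bx.toChart.source) (v : E) :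
    (modelDeriv 𝓘(ℝ, E) 𝓘(ℝ, E' × F) bx.toChart q v).1 =
      modelDeriv 𝓘(ℝ, E') 𝓘(ℝ, E') bx.base (π q) (modelDeriv 𝓘(ℝ, E) 𝓘(ℝ, E') π q v) :=
  bx.mfderiv_fst hπ hq v

theorem base_mdifferentiable (bx : SubmersionBox (E := E) (E' := E') F π q₀) :
    bx.base.MDifferentiable 𝓘(ℝ, E') 𝓘(ℝ, E') := mdifferentiable_of_mem_maximalAtlas bx.base_mem

theorem modelDeriv_eq_zero_iff (bx : SubmersionBox (E := E) (E' := E') F π q₀)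
    (hπ : ContMDiff 𝓘(ℝ, E) 𝓘(ℝ, E') ∞ π) {q : N} (hq : q ∈ bx.toChart.source) (v : E) :
    modelDeriv 𝓘(ℝ, E) 𝓘(ℝ, E') π q v = 0 ↔
      (modelDeriv 𝓘(ℝ, E) 𝓘(ℝ, E' × F) bx.toChart q v).1 = 0 := by
  rw [bx.modelDeriv_fst hπ hq]
  exact (map_eq_zero_iff _ (modelDeriv_injective bx.base_mdifferentiable (bx.mapsTo hq))).symm

theorem modelDeriv_symm_eq_zero (bx : SubmersionBox (E := E) (E' := E') F π q₀)
    (hπ : ContMDiff 𝓘(ℝ, E) 𝓘(ℝ, E') ∞ π) {p : E' × F} (hp : p ∈ bx.toChart.target) {v : E' × F}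
    (hv : v.1 = 0) : modelDeriv 𝓘(ℝ, E) 𝓘(ℝ, E') π (bx.toChart.symm p)
      (modelDeriv 𝓘(ℝ, E' × F) 𝓘(ℝ, E) bx.toChart.symm p v) = 0 := by
  rw [bx.modelDeriv_eq_zero_iff hπ (bx.toChart.map_target hp),
    modelDeriv_apply_symm bx.mdifferentiable hp, hv]

end SubmersionBox

/-! ### Descent of closed forms along a submersion with connected fibres -/

section Descent

variable {d e b k : ℕ} {M N B : Type*}
  [TopologicalSpace M] [ChartedSpace (EuclideanSpace ℝ (Fin d)) M] [IsManifold (𝓡 d) ∞ M]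
  [TopologicalSpace N] [ChartedSpace (EuclideanSpace ℝ (Fin e)) N]
  [TopologicalSpace B] [ChartedSpace (EuclideanSpace ℝ (Fin b)) B] [IsManifold (𝓡 b) ∞ B]
  {α : Form d M k} {i : N → M} {π : N → B}

/-- `f^* α` at `q`, with tangent vectors read in the model space. -/
noncomputable def Form.pullbackVal (e : ℕ) {N : Type*} [TopologicalSpace N]
    [ChartedSpace (EuclideanSpace ℝ (Fin e)) N] (i : N → M) (α : Form d M k) (q : N) :
    EuclideanSpace ℝ (Fin e) [⋀^Fin k]→L[ℝ] ℝ := α.pullback e i q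

omit [IsManifold (𝓡 d) ∞ M] in
theorem Form.flatPullback_comp {E : Type*} [NormedAddCommGroup E] [NormedSpace ℝ E]
    {s : E → N} {p : E} (hi : ContMDiff (𝓡 e) (𝓡 d) ∞ i)
    (hs : MDifferentiableAt 𝓘(ℝ, E) (𝓡 e) s p) (v : Fin k → E) :
    α.flatPullback (i ∘ s) p v =
      α.pullbackVal e i (s p) fun j => modelDeriv 𝓘(ℝ, E) (𝓡 e) s p (v j) := by
  refine α.apply_congr rfl ?_
  funext j
  exact modelDeriv_comp (hi.mdifferentiable (by simp) (s p)) hs (v j)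

omit [IsManifold (𝓡 b) ∞ B] in
-- Inside one box `i^*α` is a closed form without vertical part, hence independent of the fibre
-- coordinate, and its arguments matter only modulo vertical vectors.
theorem pullbackVal_eq_of_mem_box {F : Type*} [NormedAddCommGroup F] [NormedSpace ℝ F]
    (hα : α.Smooth) (hi : ContMDiff (𝓡 e) (𝓡 d) ∞ i) (hπ : ContMDiff (𝓡 e) (𝓡 b) ∞ π)
    (hclosed : ∀ q, α.extD.pullbackVal e i q = 0)
    (hker : ∀ q v j, modelDeriv (𝓡 e) (𝓡 b) π q (v j) = 0 → α.pullbackVal e i q v = 0)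
    {q₀ : N} (bx : SubmersionBox (E := EuclideanSpace ℝ (Fin e)) (E' := EuclideanSpace ℝ (Fin b))
      F π q₀) {q : N} (hq : q ∈ bx.toChart.source) (hqq : π q = π q₀)
    {v w : Fin k → EuclideanSpace ℝ (Fin e)}
    (hvw : ∀ j, modelDeriv (𝓡 e) (𝓡 b) π q (v j) = modelDeriv (𝓡 e) (𝓡 b) π q₀ (w j)) :
    α.pullbackVal e i q v = α.pullbackVal e i q₀ w := by
  have : FiniteDimensional ℝ (EuclideanSpace ℝ (Fin b) × F) :=
    Module.Finite.of_surjective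
      (modelDeriv (𝓡 e) 𝓘(ℝ, EuclideanSpace ℝ (Fin b) × F) bx.toChart q₀ :
        EuclideanSpace ℝ (Fin e) →ₗ[ℝ] _) (modelDeriv_surjective bx.mdifferentiable bx.mem_source)
  set A := α.flatPullback (i ∘ bx.toChart.symm) with hA
  have hop : IsOpen (bx.dom ×ˢ bx.fib) := bx.isOpen_dom.prod bx.isOpen_fib
  have hsm : ContMDiffOn 𝓘(ℝ, EuclideanSpace ℝ (Fin b) × F) (𝓡 d) ∞ (i ∘ bx.toChart.symm)
      (bx.dom ×ˢ bx.fib) := by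
    rw [← bx.target_eq]
    exact hi.comp_contMDiffOn bx.contMDiffOn_symm
  have hAv : ∀ p ∈ bx.toChart.target, ∀ v, A p v = α.pullbackVal e i (bx.toChart.symm p) fun j =>
      modelDeriv 𝓘(ℝ, EuclideanSpace ℝ (Fin b) × F) (𝓡 e) bx.toChart.symm p (v j) := fun p hp v =>
    Form.flatPullback_comp hi (bx.mdifferentiable.mdifferentiableAt_symm hp) v
  have hAq : ∀ q ∈ bx.toChart.source, ∀ v, α.pullbackVal e i q v = A (bx.toChart q) fun j =>
      modelDeriv (𝓡 e) 𝓘(ℝ, EuclideanSpace ℝ (Fin b) × F) bx.toChart q (v j) := by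
    intro q hq v
    rw [hAv _ (bx.toChart.map_source hq)]
    simp only [modelDeriv_symm_apply bx.mdifferentiable hq]
    rw [bx.toChart.left_inv hq]
  have hAvert : ∀ p ∈ bx.toChart.target, ∀ (v : Fin k → EuclideanSpace ℝ (Fin b) × F) (j : Fin k),
      (v j).1 = 0 → A p v = 0 := by
    intro p hp v j hv
    rw [hAv p hp]
    exact hker _ _ j (bx.modelDeriv_symm_eq_zero hπ hp hv)
  have hconst : A (bx.toChart q) = A (bx.toChart q₀) := by
    have h1 := bx.mem_target hq
    have h2 := bx.mem_target bx.mem_source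
    have h3 : ∀ x ∈ bx.toChart.source, bx.toChart x = (bx.base (π x), (bx.toChart x).2) :=
      fun x hx => Prod.ext (bx.fst_eq x hx) rfl
    rw [h3 q hq, h3 q₀ bx.mem_source, hqq]
    refine eq_of_extDeriv_eq_zero_of_vertical bx.isOpen_dom bx.isOpen_fib bx.convex_fib
      (Form.contDiffOn_flatPullback hα hop hsm) (fun p hp => ?_) (fun p hp v j hv => ?_)
      h2.1 h1.2 h2.2
    · rw [← bx.target_eq] at hp
      rw [Form.extDeriv_flatPullback hα hop hsm (bx.target_eq ▸ hp)]
      ext v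
      rw [Form.flatPullback_comp hi (bx.mdifferentiable.mdifferentiableAt_symm hp), hclosed]
      rfl
    · rw [← bx.target_eq] at hp
      exact hAvert p hp v j hv
  rw [hAq q hq, hAq q₀ bx.mem_source, hconst]
  refine alternating_congr_mod (f := (A (bx.toChart q₀)).toAlternatingMap)
    (K := LinearMap.ker (LinearMap.fst ℝ (EuclideanSpace ℝ (Fin b)) F)) (fun u j hu => ?_)
    fun j => ?_
  · exact hAvert _ (bx.toChart.map_source bx.mem_source) u j hu
  · rw [LinearMap.mem_ker, map_sub, sub_eq_zero]
    change (modelDeriv (𝓡 e) 𝓘(ℝ, EuclideanSpace ℝ (Fin b) × F) bx.toChart q (v j)).1 =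
      (modelDeriv (𝓡 e) 𝓘(ℝ, EuclideanSpace ℝ (Fin b) × F) bx.toChart q₀ (w j)).1
    rw [bx.modelDeriv_fst hπ hq, bx.modelDeriv_fst hπ bx.mem_source, hvw j, hqq]

omit [IsManifold (𝓡 b) ∞ B] in
-- The statement for boxes is chained along the connected fibre.
theorem pullbackVal_eq_of_proj_eq
    (hα : α.Smooth) (hi : ContMDiff (𝓡 e) (𝓡 d) ∞ i) (hπ : IsSubmersion (𝓡 e) (𝓡 b) ∞ π)
    (hconn : ∀ y, IsPreconnected (π ⁻¹' {y}))
    (hclosed : ∀ q, α.extD.pullbackVal e i q = 0)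
    (hker : ∀ q v j, modelDeriv (𝓡 e) (𝓡 b) π q (v j) = 0 → α.pullbackVal e i q v = 0)
    {q q' : N} (hqq : π q = π q') {v w : Fin k → EuclideanSpace ℝ (Fin e)}
    (hvw : ∀ j, modelDeriv (𝓡 e) (𝓡 b) π q (v j) = modelDeriv (𝓡 e) (𝓡 b) π q' (w j)) :
    α.pullbackVal e i q v = α.pullbackVal e i q' w := by
  let P : N → N → Prop := fun q q' => ∀ v w : Fin k → EuclideanSpace ℝ (Fin e),
    (∀ j, modelDeriv (𝓡 e) (𝓡 b) π q (v j) = modelDeriv (𝓡 e) (𝓡 b) π q' (w j)) →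
      α.pullbackVal e i q v = α.pullbackVal e i q' w
  have hsymm : ∀ {q q'}, P q q' → P q' q := fun h v w hvw =>
    (h w v fun j => (hvw j).symm).symm
  have hP : P q q' := by
    refine (hconn (π q')).induction₂' P (fun x hx => ?_) (fun x y z _ _ _ hxy hyz v w hvw => ?_)
      (show q ∈ π ⁻¹' {π q'} from hqq) rfl
    · obtain ⟨bx⟩ := exists_submersionBox (hπ.isSubmersionOfComplement_complement x)
      filter_upwards [mem_nhdsWithin_of_mem_nhds (bx.toChart.open_source.mem_nhds bx.mem_source),
        self_mem_nhdsWithin] with y hy hy'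
      have h1 : P y x := fun v w hvw =>
        pullbackVal_eq_of_mem_box hα hi hπ.contMDiff hclosed hker bx hy (hy'.trans hx.symm) hvw
      exact ⟨hsymm h1, h1⟩
    -- For transitivity, `dπ` at the intermediate point is onto, so the vectors can be lifted there.
    · have hs := mfderiv_surjective_of_isSubmersion hπ y
      have hs' : ∀ j, ∃ u, modelDeriv (𝓡 e) (𝓡 b) π y u = modelDeriv (𝓡 e) (𝓡 b) π x (v j) :=
        fun j => hs _
      choose u hu using hs'
      exact (hxy v u fun j => (hu j).symm).trans (hyz u w fun j => (hu j).trans (hvw j))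
  exact hP v w hvw

/-- A closed form on `N` that vanishes on `ker dπ` descends along a submersion `π` with connected
fibres. -/
theorem exists_descended_form
    (hα : α.Smooth) (hi : ContMDiff (𝓡 e) (𝓡 d) ∞ i) (hπ : IsSubmersion (𝓡 e) (𝓡 b) ∞ π)
    (hsurj : Function.Surjective π) (hconn : ∀ y, IsPreconnected (π ⁻¹' {y}))
    (hclosed : ∀ q, α.extD.pullbackVal e i q = 0)
    (hker : ∀ q v j, modelDeriv (𝓡 e) (𝓡 b) π q (v j) = 0 → α.pullbackVal e i q v = 0) :
    ∃ β : Form b B k, β.Smooth ∧ β.extD = 0 ∧ β.pullback e π = α.pullback e i := by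
  -- The value on the base is defined by lifting vectors at one point of the fibre; independence of
  -- the lift and of the point makes it correct at all of them.
  have hex : ∀ y : B, ∃ β : EuclideanSpace ℝ (Fin b) [⋀^Fin k]→L[ℝ] ℝ, ∀ q, π q = y →
      ∀ v, β (fun j => modelDeriv (𝓡 e) (𝓡 b) π q (v j)) = α.pullbackVal e i q v := by
    intro y
    obtain ⟨q₀, hq₀⟩ := hsurj y
    have hs : Function.Surjective (modelDeriv (𝓡 e) (𝓡 b) π q₀) :=
      mfderiv_surjective_of_isSubmersion hπ q₀
    obtain ⟨S, hS⟩ := LinearMap.exists_rightInverse_of_surjective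
      (modelDeriv (𝓡 e) (𝓡 b) π q₀ : EuclideanSpace ℝ (Fin e) →ₗ[ℝ] EuclideanSpace ℝ (Fin b))
      (LinearMap.range_eq_top.2 hs)
    refine ⟨(α.pullbackVal e i q₀).compContinuousLinearMap S.toContinuousLinearMap,
      fun q hq v => ?_⟩
    exact pullbackVal_eq_of_proj_eq hα hi hπ hconn hclosed hker (hq₀.trans hq.symm)
      fun j => LinearMap.congr_fun hS _
  choose β hβ using hex
  let β' : Form b B k := β
  -- With a local section `σ` of `π`, the descended form is `σ^* i^* α`; smoothness and closedness
  -- are then inherited from `α`.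
  have hflat : ∀ (V : Set B) (σ : B → N), IsOpen V → ContMDiffOn (𝓡 b) (𝓡 e) ∞ σ V →
      (∀ y ∈ V, π (σ y) = y) → ∀ (c : B), ∀ y ∈ (extChartAt (𝓡 b) c).target ∩
        (extChartAt (𝓡 b) c).symm ⁻¹' V,
      β'.inChart c y = α.flatPullback (i ∘ σ ∘ (extChartAt (𝓡 b) c).symm) y := by
    intro V σ hV hσ hπσ c y hy
    have h1 : MDifferentiableAt (𝓡 b) (𝓡 b) (extChartAt (𝓡 b) c).symm y :=
      ((contMDiffOn_extChartAt_symm (I := 𝓡 b) (n := ∞) c).contMDiffAt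
        ((isOpen_extChartAt_target c).mem_nhds hy.1)).mdifferentiableAt (by simp)
    have h2 : MDifferentiableAt (𝓡 b) (𝓡 e) σ ((extChartAt (𝓡 b) c).symm y) :=
      (hσ.contMDiffAt (hV.mem_nhds hy.2)).mdifferentiableAt (by simp)
    ext v
    rw [Form.flatPullback_comp hi (h2.comp y h1)]
    rw [Function.comp_apply, ← hβ _ _ (hπσ _ hy.2)]
    refine congrArg (β _) ?_
    funext j
    rw [modelDeriv_comp h2 h1]
    exact (mfderiv_comp_section hπ.contMDiff hV hσ hπσ hy.2 _).symm
  have hloc : ∀ (c : B), ∀ y ∈ (extChartAt (𝓡 b) c).target, ∃ O : Set (EuclideanSpace ℝ (Fin b)),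
      IsOpen O ∧ y ∈ O ∧ ∃ g : EuclideanSpace ℝ (Fin b) → N,
        ContMDiffOn (𝓡 b) (𝓡 e) ∞ g O ∧ ∀ y' ∈ O, β'.inChart c y' = α.flatPullback (i ∘ g) y' := by
    intro c y hy
    obtain ⟨q, hq⟩ := hsurj ((extChartAt (𝓡 b) c).symm y)
    obtain ⟨V, σ, hV, hqV, hσ, -, hπσ⟩ := exists_local_section hπ q
    have hsm := contMDiffOn_extChartAt_symm (I := 𝓡 b) (n := ∞) c
    exact ⟨_, hsm.continuousOn.isOpen_inter_preimage (isOpen_extChartAt_target c) hV,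
      ⟨hy, by rw [mem_preimage, ← hq]; exact hqV⟩, σ ∘ (extChartAt (𝓡 b) c).symm,
      hσ.comp (hsm.mono inter_subset_left) fun _ h => h.2, hflat V σ hV hσ hπσ c⟩
  refine ⟨β', ?_, ?_, ?_⟩
  · intro c y hy
    obtain ⟨O, hO, hyO, g, hg, heq⟩ := hloc c y hy
    exact (((Form.contDiffOn_flatPullback hα hO (hi.comp_contMDiffOn hg)).congr heq).contDiffAt
      (hO.mem_nhds hyO)).contDiffWithinAt
  · funext x
    obtain ⟨O, hO, hyO, g, hg, heq⟩ := hloc x (extChartAt (𝓡 b) x x) (mem_extChartAt_target x)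
    have h1 : β'.inChart x =ᶠ[𝓝 (extChartAt (𝓡 b) x x)] α.flatPullback (i ∘ g) := by
      filter_upwards [hO.mem_nhds hyO] with y hy using heq y hy
    have h2 : extDeriv (β'.inChart x) (extChartAt (𝓡 b) x x) = 0 := by
      rw [h1.extDeriv_eq, Form.extDeriv_flatPullback hα hO (hi.comp_contMDiffOn hg) hyO]
      ext v
      rw [Form.flatPullback_comp hi ((hg.contMDiffAt (hO.mem_nhds hyO)).mdifferentiableAt
        (by simp)), hclosed]
      rfl
    rw [Form.extD, h2]
    rfl
  · funext q
    ext v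
    exact hβ _ q rfl v

end Descent

section ModelDerivative

variable {E E' : Type*} [NormedAddCommGroup E] [NormedSpace ℝ E]
  [NormedAddCommGroup E'] [NormedSpace ℝ E']
  {N : Type*} [TopologicalSpace N] [ChartedSpace E N]
  {B : Type*} [TopologicalSpace B] [ChartedSpace E' B] {f : N → B}

theorem modelDeriv_surjective_of_isSubmersion (h : IsSubmersion 𝓘(ℝ, E) 𝓘(ℝ, E') ∞ f) (q : N) :
    Function.Surjective (modelDeriv 𝓘(ℝ, E) 𝓘(ℝ, E') f q) :=
  mfderiv_surjective_of_isSubmersion h q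

theorem modelDeriv_injective_of_isImmersion (h : IsImmersion 𝓘(ℝ, E) 𝓘(ℝ, E') ∞ f) (q : N) :
    Function.Injective (modelDeriv 𝓘(ℝ, E) 𝓘(ℝ, E') f q) :=
  mfderiv_injective_of_isImmersionAt (h.isImmersionAt q)

end ModelDerivative

/-! ### Tangent spaces of fibres that are only known to be immersed -/

section Fibres

variable {e b r : ℕ} {N B X : Type*}
  [TopologicalSpace N] [ChartedSpace (EuclideanSpace ℝ (Fin e)) N]
  [TopologicalSpace B] [ChartedSpace (EuclideanSpace ℝ (Fin b)) B]
  [TopologicalSpace X] [ChartedSpace (EuclideanSpace ℝ (Fin r)) X] [IsManifold (𝓡 r) ∞ X]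
  [SecondCountableTopology X] {π : N → B} {s : X → N} {y : B}

/-- A second countable manifold that is immersed onto a fibre of a submersion has the kernel of
the derivative of the submersion as its tangent spaces. -/
theorem range_modelDeriv_eq_ker (hs : ContMDiff (𝓡 r) (𝓡 e) ∞ s)
    (hinj : ∀ x, Function.Injective (modelDeriv (𝓡 r) (𝓡 e) s x))
    (hπ : IsSubmersion (𝓡 e) (𝓡 b) ∞ π) (hrange : range s = π ⁻¹' {y}) (x : X) :
    LinearMap.range (modelDeriv (𝓡 r) (𝓡 e) s x :
        EuclideanSpace ℝ (Fin r) →ₗ[ℝ] EuclideanSpace ℝ (Fin e)) =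
      LinearMap.ker (modelDeriv (𝓡 e) (𝓡 b) π (s x) :
        EuclideanSpace ℝ (Fin e) →ₗ[ℝ] EuclideanSpace ℝ (Fin b)) := by
  have hπs : ∀ x', π (s x') = y := fun x' => (hrange ▸ mem_range_self x' : s x' ∈ π ⁻¹' {y})
  have hsd : MDifferentiable (𝓡 r) (𝓡 e) s := hs.mdifferentiable (by simp)
  have hzero : ∀ x' v, modelDeriv (𝓡 e) (𝓡 b) π (s x') (modelDeriv (𝓡 r) (𝓡 e) s x' v) = 0 := by
    intro x' v
    rw [← modelDeriv_comp (hπ.contMDiff.mdifferentiable (by simp) _) (hsd x'),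
      show π ∘ s = fun _ => y from funext hπs]
    exact congrArg (fun A : EuclideanSpace ℝ (Fin r) →L[ℝ] EuclideanSpace ℝ (Fin b) => A v)
      (mfderiv_const (I := 𝓡 r) (I' := 𝓡 b) (c := y) (x := x'))
  obtain ⟨F, _, _, ⟨bx⟩⟩ : ∃ (F : Type) (_ : NormedAddCommGroup F) (_ : NormedSpace ℝ F),
      Nonempty (SubmersionBox (E := EuclideanSpace ℝ (Fin e)) (E' := EuclideanSpace ℝ (Fin b))
        F π (s x)) :=
    ⟨hπ.complement, inferInstance, inferInstance,
      exists_submersionBox (hπ.isSubmersionOfComplement_complement (s x))⟩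
  have hbij : Function.Bijective (modelDeriv (𝓡 e) 𝓘(ℝ, EuclideanSpace ℝ (Fin b) × F)
      bx.toChart (s x)) :=
    ⟨modelDeriv_injective bx.mdifferentiable bx.mem_source,
      modelDeriv_surjective bx.mdifferentiable bx.mem_source⟩
  have hfin : FiniteDimensional ℝ (EuclideanSpace ℝ (Fin b) × F) := Module.Finite.of_surjective
      (modelDeriv (𝓡 e) 𝓘(ℝ, EuclideanSpace ℝ (Fin b) × F) bx.toChart (s x) :
        EuclideanSpace ℝ (Fin e) →ₗ[ℝ] _) hbij.2
  have hfinF : FiniteDimensional ℝ F := Module.Finite.of_surjective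
    (LinearMap.snd ℝ (EuclideanSpace ℝ (Fin b)) F) LinearMap.snd_surjective
  have hdim : e = b + Module.finrank ℝ F := by
    have := (LinearEquiv.ofBijective (modelDeriv (𝓡 e) 𝓘(ℝ, EuclideanSpace ℝ (Fin b) × F)
      bx.toChart (s x) : EuclideanSpace ℝ (Fin e) →ₗ[ℝ] EuclideanSpace ℝ (Fin b) × F)
      hbij).finrank_eq
    simpa using this
  -- The fibre coordinate along `s`. It is an immersion, because `s` is one and its base coordinate
  -- has zero derivative.
  let g : X → F := fun x' => (bx.toChart (s x')).2
  have hW : IsOpen (s ⁻¹' bx.toChart.source) :=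
    bx.toChart.open_source.preimage hs.continuous
  have hg : ContMDiffOn (𝓡 r) 𝓘(ℝ, F) ∞ g (s ⁻¹' bx.toChart.source) :=
    (contDiff_snd (𝕜 := ℝ) (E := EuclideanSpace ℝ (Fin b)) (F := F)).contMDiff.comp_contMDiffOn
      (bx.contMDiffOn.comp hs.contMDiffOn fun _ h => h)
  have hgd : ∀ x' ∈ s ⁻¹' bx.toChart.source, ∀ v, modelDeriv (𝓡 r) 𝓘(ℝ, F) g x' v =
      (modelDeriv (𝓡 e) 𝓘(ℝ, EuclideanSpace ℝ (Fin b) × F) bx.toChart (s x')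
        (modelDeriv (𝓡 r) (𝓡 e) s x' v)).2 := by
    intro x' hx' v
    have h1 : MDifferentiableAt (𝓡 e) 𝓘(ℝ, EuclideanSpace ℝ (Fin b) × F) bx.toChart (s x') :=
      bx.mdifferentiable.mdifferentiableAt hx'
    have h2 : MDifferentiableAt 𝓘(ℝ, EuclideanSpace ℝ (Fin b) × F) 𝓘(ℝ, F) Prod.snd
        (bx.toChart (s x')) := differentiableAt_snd.mdifferentiableAt
    have h3 : modelDeriv 𝓘(ℝ, EuclideanSpace ℝ (Fin b) × F) 𝓘(ℝ, F) Prod.snd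
        (bx.toChart (s x')) = ContinuousLinearMap.snd ℝ _ _ := by
      rw [modelDeriv, mfderiv_eq_fderiv, fderiv_snd]
    have h4 := modelDeriv_comp (h2.comp (s x') h1) (hsd x') v
    rw [modelDeriv_comp h2 h1, h3] at h4
    exact h4
  have hrank := dimH_image_le_of_finrank_range_mfderiv hW hg (r := r) fun x' hx' => by
    have hgi : Function.Injective (modelDeriv (𝓡 r) 𝓘(ℝ, F) g x') := by
      refine (injective_iff_map_eq_zero _).2 fun v hv => hinj x' ?_
      rw [map_zero]
      refine modelDeriv_injective bx.mdifferentiable hx' ?_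
      rw [map_zero]
      exact Prod.ext ((bx.modelDeriv_eq_zero_iff hπ.contMDiff hx' _).1 (hzero x' v))
        ((hgd x' hx' v).symm.trans hv)
    exact (LinearMap.finrank_range_of_inj (f := (modelDeriv (𝓡 r) 𝓘(ℝ, F) g x' :
      EuclideanSpace ℝ (Fin r) →ₗ[ℝ] F)) hgi).trans finrank_euclideanSpace_fin
  -- Since `s` is onto the fibre, `g` covers an open subset of `F`. With the Hausdorff bound this
  -- gives `dim F ≤ r`, that is, `dim ker dπ ≤ r`.
  have hfib : bx.fib ⊆ g '' (s ⁻¹' bx.toChart.source) := by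
    intro z hz
    have h1 := bx.mem_target bx.mem_source
    have h2 : (bx.base (π (s x)), z) ∈ bx.toChart.target := by
      rw [bx.target_eq]; exact ⟨h1.1, hz⟩
    have h3 := bx.proj_symm h2
    rw [bx.base.left_inv (bx.mapsTo bx.mem_source), hπs] at h3
    obtain ⟨x', hx'⟩ : bx.toChart.symm (bx.base (π (s x)), z) ∈ range s := by
      rw [hrange, hπs]; exact h3
    refine ⟨x', ?_, ?_⟩
    · rw [mem_preimage, hx']; exact bx.toChart.map_target h2
    · change (bx.toChart (s x')).2 = z
      rw [hx', bx.toChart.right_inv h2]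
  have hFr : Module.finrank ℝ F ≤ r := by
    have h1 := (dimH_mono hfib).trans hrank
    rw [Real.dimH_of_nonempty_interior] at h1
    · exact_mod_cast h1
    · rw [bx.isOpen_fib.interior_eq]
      exact ⟨_, (bx.mem_target bx.mem_source).2⟩
  have hker := LinearMap.finrank_range_add_finrank_ker (modelDeriv (𝓡 e) (𝓡 b) π (s x) :
        EuclideanSpace ℝ (Fin e) →ₗ[ℝ] EuclideanSpace ℝ (Fin b))
  rw [LinearMap.range_eq_top.2 (modelDeriv_surjective_of_isSubmersion hπ (s x)), finrank_top,
    finrank_euclideanSpace_fin, finrank_euclideanSpace_fin] at hker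
  refine Submodule.eq_of_le_of_finrank_le ?_ ?_
  · rintro _ ⟨v, rfl⟩
    exact hzero x v
  · have := LinearMap.finrank_range_of_inj (f := (modelDeriv (𝓡 r) (𝓡 e) s x :
      EuclideanSpace ℝ (Fin r) →ₗ[ℝ] EuclideanSpace ℝ (Fin e))) (hinj x)
    rw [finrank_euclideanSpace_fin] at this
    omega

end Fibres

/-! ### Leaves as fibres of the projection -/

section LeafProjection

variable {e b : ℕ} {N : Type*} {B : Type*}
  [TopologicalSpace N] [ChartedSpace (EuclideanSpace ℝ (Fin e)) N]
  [TopologicalSpace B] [ChartedSpace (EuclideanSpace ℝ (Fin b)) B]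
  {D : Distribution e N} {π : N → B}

omit [TopologicalSpace B] in
theorem IsLeafProjection.isIntegralManifold (h : IsLeafProjection D π) (y : B) :
    IsIntegralManifold D (π ⁻¹' {y}) := ((h.2 _).2 ⟨y, rfl⟩).prop

omit [TopologicalSpace B] in
theorem IsLeafProjection.isPreconnected (h : IsLeafProjection D π) (y : B) :
    IsPreconnected (π ⁻¹' {y}) := by
  obtain ⟨r, X, _, _, _, _, _, _, s, hs, hrange, -⟩ := h.isIntegralManifold y
  rw [← hrange]
  exact isPreconnected_range hs.immersion.contMDiff.continuous

/-- This links the algebra to the geometry: `D = ker dπ`, since each fibre is an immersed leaf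
tangent to `D`. -/
theorem IsLeafProjection.mem_iff (h : IsLeafProjection D π) (hπ : IsSubmersion (𝓡 e) (𝓡 b) ∞ π)
    (q : N) (v : EuclideanSpace ℝ (Fin e)) :
    v ∈ D q ↔ modelDeriv (𝓡 e) (𝓡 b) π q v = 0 := by
  obtain ⟨r, X, _, _, _, _, _, _, s, hs, hrange, hD⟩ := h.isIntegralManifold (π q)
  obtain ⟨x, rfl⟩ : q ∈ range s := by rw [hrange]; rfl
  rw [← hD x]
  exact SetLike.ext_iff.1 (range_modelDeriv_eq_ker hs.immersion.contMDiff
    (fun x' => modelDeriv_injective_of_isImmersion hs.immersion x') hπ hrange x) v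

end LeafProjection

/-! ### Reeb vectors under linear reduction -/

section LinearReduction

variable {V U V' : Type*} [AddCommGroup V] [Module ℝ V] [AddCommGroup U] [Module ℝ U]
  [AddCommGroup V'] [Module ℝ V'] [FiniteDimensional ℝ V]
  {om : V [⋀^Fin 2]→ₗ[ℝ] ℝ} {lam : V [⋀^Fin 1]→ₗ[ℝ] ℝ} {R : V}

theorem IsReebVector.mem_orth_of_mem (h : IsReebVector om lam R) {W : Submodule ℝ V} (hR : R ∈ W)
    {v : V} : v ∈ orth om lam W ↔ covector lam v = 0 ∧ ∀ w ∈ W, bilin om v w = 0 := by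
  rw [h.mem_orth]
  refine and_congr_right fun _ => ⟨fun h2 w hw => ?_, fun h2 w hw _ => h2 w hw⟩
  have := h2 (w - covector lam w • R) (W.sub_mem hw (W.smul_mem _ hR)) (by simp [h.covector_eq])
  rwa [map_sub, map_smul, h.bilin_right, smul_zero, sub_zero] at this

/-- The image of the Reeb vector under a linear reduction is a Reeb vector. -/
theorem IsReebVector.map {om' : V' [⋀^Fin 2]→ₗ[ℝ] ℝ} {lam' : V' [⋀^Fin 1]→ₗ[ℝ] ℝ} {ι : U →ₗ[ℝ] V}
    {ρ : U →ₗ[ℝ] V'} {r : U} (h : IsReebVector om lam (ι r)) (hρ : Function.Surjective ρ)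
    (hbilin : ∀ u w, bilin om' (ρ u) (ρ w) = bilin om (ι u) (ι w))
    (hcovector : ∀ u, covector lam' (ρ u) = covector lam (ι u))
    (hker : ∀ u, ι u ∈ orth om lam (LinearMap.range ι) → ρ u = 0) :
    IsReebVector om' lam' (ρ r) where
  bilin_eq := by
    ext w
    obtain ⟨u, rfl⟩ := hρ w
    rw [hbilin, h.bilin_left]; rfl
  covector_eq := by rw [hcovector, h.covector_eq]
  eq_zero v h1 h2 := by
    obtain ⟨u, rfl⟩ := hρ v
    refine hker u ((h.mem_orth_of_mem (W := LinearMap.range ι) (LinearMap.mem_range_self ι r)).2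
      ⟨by rw [← hcovector, h2], ?_⟩)
    rintro _ ⟨w, rfl⟩
    rw [← hbilin, h1]; rfl

end LinearReduction

/-! ### Pointwise data of a stable Hamiltonian structure -/

section Pointwise

variable {d : ℕ} {M : Type*} [TopologicalSpace M] [ChartedSpace (EuclideanSpace ℝ (Fin d)) M]
  {k : ℕ}

/-- A form at a point as an alternating map on the model space. -/
noncomputable def Form.alt (α : Form d M k) (x : M) : EuclideanSpace ℝ (Fin d) [⋀^Fin k]→ₗ[ℝ] ℝ :=
  (α x).toAlternatingMap

theorem IsStableHamiltonian.exists_isReebVector {om : Form d M 2} {lam : Form d M 1}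
    (h : IsStableHamiltonian om lam) (x : M) : ∃ R, IsReebVector (om.alt x) (lam.alt x) R := by
  obtain ⟨n, hn, hv⟩ := h.volume
  obtain ⟨v, hv⟩ := hv x
  exact SHS.exists_isReebVector (finrank_euclideanSpace_fin.trans hn) hv

variable {e b : ℕ} {N B : Type*} [TopologicalSpace N] [ChartedSpace (EuclideanSpace ℝ (Fin e)) N]
  [TopologicalSpace B] [ChartedSpace (EuclideanSpace ℝ (Fin b)) B]
  {om : Form d M 2} {lam : Form d M 1} {i : N → M} {π : N → B}

/-- The derivative as a linear map between the model spaces. -/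
noncomputable def tanMap (e d : ℕ) {M N : Type*}
    [TopologicalSpace M] [ChartedSpace (EuclideanSpace ℝ (Fin d)) M]
    [TopologicalSpace N] [ChartedSpace (EuclideanSpace ℝ (Fin e)) N] (f : N → M) (q : N) :
    EuclideanSpace ℝ (Fin e) →ₗ[ℝ] EuclideanSpace ℝ (Fin d) := modelDeriv (𝓡 e) (𝓡 d) f q

theorem Form.pullback_one_apply (lam : Form d M 1) (q : N) (u : EuclideanSpace ℝ (Fin e)) :
    lam.pullbackVal e i q ![u] = covector (lam.alt (i q)) (tanMap e d i q u) :=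
  (lam.alt (i q)).congr_arg (by funext j; fin_cases j; rfl)

theorem Form.pullback_two_apply (om : Form d M 2) (q : N) (u w : EuclideanSpace ℝ (Fin e)) :
    om.pullbackVal e i q ![u, w] =
      bilin (om.alt (i q)) (tanMap e d i q u) (tanMap e d i q w) :=
  (om.alt (i q)).congr_arg (by funext j; fin_cases j <;> rfl)

theorem Form.eq_of_pullback_eq {α β : Form b B k} (hπ : Function.Surjective π)
    (hd : ∀ q, Function.Surjective (tanMap e b π q)) (h : α.pullback e π = β.pullback e π) :
    α = β := by
  funext y
  obtain ⟨q, rfl⟩ := hπ y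
  ext v
  choose u hu using fun j => hd q (v j)
  have h1 : α.pullbackVal e π q u = β.pullbackVal e π q u := by
    rw [Form.pullbackVal, h]; rfl
  rw [show v = fun j => tanMap e b π q (u j) from funext fun j => (hu j).symm]
  exact h1

theorem IsVertical.mem_range (h : IsVertical e om lam i) {q : N} {R : EuclideanSpace ℝ (Fin d)}
    (hR : IsReebVector (om.alt (i q)) (lam.alt (i q)) R) : ∃ r, tanMap e d i q r = R := by
  have := h q
  exact hR.reeb_eq ▸ this

/-- `i^* d lam = 0` if it vanishes on horizontal vectors of a vertical submanifold. -/
theorem IsVertical.pullbackVal_extD_eq_zero (h : IsVertical e om lam i)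
    (hM : IsStableHamiltonian om lam)
    (hdlam : ∀ (q : N) (u v : TangentSpace (𝓡 e) q),
      lam.pullback e i q ![u] = 0 → lam.pullback e i q ![v] = 0 →
        lam.extD.pullback e i q ![u, v] = 0) (q : N) : lam.extD.pullbackVal e i q = 0 := by
  obtain ⟨R, hR⟩ := hM.exists_isReebVector (i q)
  obtain ⟨r, rfl⟩ := h.mem_range hR
  have hleft : ∀ w, bilin (lam.extD.alt (i q)) (tanMap e d i q r) w = 0 :=
    fun w => hM.ker_le (i q) _ (fun w' => hR.bilin_left w') w
  have hright : ∀ w, bilin (lam.extD.alt (i q)) w (tanMap e d i q r) = 0 := fun w => by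
    rw [bilin_swap, hleft, neg_zero]
  let a : EuclideanSpace ℝ (Fin e) → ℝ := fun u => covector (lam.alt (i q)) (tanMap e d i q u)
  -- Subtracting the Reeb component makes a tangent vector of `N` horizontal; `R` contributes
  -- nothing to `d lam`, so the hypothesis on horizontal vectors suffices.
  have ha : ∀ u, lam.pullbackVal e i q ![u - a u • r] = 0 := fun u => by
    rw [Form.pullback_one_apply, map_sub, map_smul, map_sub, map_smul, hR.covector_eq]
    simp [a]
  ext v
  have h1 : lam.extD.pullbackVal e i q ![v 0 - a (v 0) • r, v 1 - a (v 1) • r] = 0 :=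
    hdlam q _ _ (ha _) (ha _)
  rw [Form.pullback_two_apply, map_sub, map_smul, map_sub (tanMap e d i q), map_smul, map_sub,
    map_smul, map_sub, map_smul, LinearMap.sub_apply,
    LinearMap.sub_apply, LinearMap.smul_apply, LinearMap.smul_apply, hright, hleft, hright] at h1
  rw [show v = ![v 0, v 1] by funext j; fin_cases j <;> rfl, Form.pullback_two_apply]
  simpa using h1

end Pointwise

/-! ### Existence and uniqueness of the reduced structure -/

section Reduction

variable {d e b : ℕ} {M N B : Type*}
  [TopologicalSpace M] [ChartedSpace (EuclideanSpace ℝ (Fin d)) M] [IsManifold (𝓡 d) ∞ M]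
  [TopologicalSpace N] [ChartedSpace (EuclideanSpace ℝ (Fin e)) N]
  [TopologicalSpace B] [ChartedSpace (EuclideanSpace ℝ (Fin b)) B] [IsManifold (𝓡 b) ∞ B]
  {om : Form d M 2} {lam : Form d M 1} {i : N → M} {π : N → B}

/-- Both forms descend, `i^*lam` because it is closed on `N`. The Reeb vector is pushed down to
establish nondegeneracy, and nondegeneracy yields the volume condition. -/
theorem IsStableHamiltonian.exists_isReduced [Nonempty N] (hM : IsStableHamiltonian om lam)
    (hi : ContMDiff (𝓡 e) (𝓡 d) ∞ i) (hvert : IsVertical e om lam i)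
    (hleaf : IsLeafProjection (charDistribution e om lam i) π)
    (hπ : IsSubmersion (𝓡 e) (𝓡 b) ∞ π)
    (hdlam : ∀ q, lam.extD.pullbackVal e i q = 0) :
    ∃ (omN : Form b B 2) (lamN : Form b B 1), IsReduced e om lam i π omN lamN := by
  have hchar : ∀ q v, modelDeriv (𝓡 e) (𝓡 b) π q v = 0 ↔ tanMap e d i q v ∈
      orth (om.alt (i q)) (lam.alt (i q)) (LinearMap.range (tanMap e d i q)) :=
    fun q v => (hleaf.mem_iff hπ q v).symm
  have horth : ∀ q v, modelDeriv (𝓡 e) (𝓡 b) π q v = 0 →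
      covector (lam.alt (i q)) (tanMap e d i q v) = 0 ∧
        ∀ w, bilin (om.alt (i q)) (tanMap e d i q v) (tanMap e d i q w) = 0 := by
    intro q v hv
    obtain ⟨R, hR⟩ := hM.exists_isReebVector (i q)
    have := (hR.mem_orth_of_mem (hvert.mem_range hR)).1 ((hchar q v).1 hv)
    exact ⟨this.1, fun w => this.2 _ ⟨w, rfl⟩⟩
  obtain ⟨omN, homs, homc, hompb⟩ := exists_descended_form (α := om) (π := π) hM.smooth_omega hi hπ
    hleaf.1 hleaf.isPreconnected (fun q => by rw [hM.closed]; rfl) fun q v j hj => by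
      rw [show v = ![v 0, v 1] by funext j; fin_cases j <;> rfl, Form.pullback_two_apply]
      fin_cases j
      · exact (horth q _ hj).2 _
      · rw [bilin_swap, neg_eq_zero]
        exact (horth q _ hj).2 _
  obtain ⟨lamN, hlams, hlamc, hlampb⟩ := exists_descended_form (α := lam) (π := π) hM.smooth_lam hi
    hπ hleaf.1 hleaf.isPreconnected hdlam fun q v j hj => by
      rw [show v = ![v 0] by funext j; fin_cases j; rfl, Form.pullback_one_apply]
      fin_cases j
      exact (horth q _ hj).1
  have hreeb : ∀ y, ∃ R', IsReebVector (omN.alt y) (lamN.alt y) R' := by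
    intro y
    obtain ⟨q, rfl⟩ := hleaf.1 y
    obtain ⟨R, hR⟩ := hM.exists_isReebVector (i q)
    obtain ⟨r, rfl⟩ := hvert.mem_range hR
    refine ⟨tanMap e b π q r, hR.map (modelDeriv_surjective_of_isSubmersion hπ q)
      (fun u w => ?_) (fun u => ?_) fun u => (hchar q u).2⟩
    · rw [← Form.pullback_two_apply, ← Form.pullback_two_apply, Form.pullbackVal, hompb]
      rfl
    · rw [← Form.pullback_one_apply, ← Form.pullback_one_apply, Form.pullbackVal, hlampb]
      rfl
  -- The condition `ker om ⊆ ker (d lam)` is free, because the descended `lamN` is closed.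
  refine ⟨omN, lamN, ⟨homs, hlams, homc, ?_, fun x v _ w => by rw [hlamc]; rfl⟩, hompb, hlampb⟩
  have hvol : ∀ y : B, ∃ n, b = 2 * n + 1 ∧ ∃ v : Fin (2 * n + 1) → EuclideanSpace ℝ (Fin b),
      wedgeTop n (omN.alt y) (lamN.alt y) v ≠ 0 := by
    intro y
    obtain ⟨R', hR'⟩ := hreeb y
    obtain ⟨n, hn, hv⟩ := hR'.exists_wedgeTop_ne_zero
    exact ⟨n, finrank_euclideanSpace_fin.symm.trans hn, hv⟩
  -- A point of `N` is needed to know that the dimension `b` is odd; `b` then fixes the same `n`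
  -- everywhere.
  obtain ⟨n, hn, -⟩ := hvol (π (Classical.arbitrary N))
  refine ⟨n, hn, fun y => ?_⟩
  obtain ⟨n', hn', hv⟩ := hvol y
  obtain rfl : n' = n := by omega
  exact hv

omit [IsManifold (𝓡 d) ∞ M] [IsManifold (𝓡 b) ∞ B] in
theorem IsReduced.eq {omN omN' : Form b B 2} {lamN lamN' : Form b B 1}
    (h : IsReduced e om lam i π omN lamN) (h' : IsReduced e om lam i π omN' lamN')
    (hsurj : Function.Surjective π) (hπ : IsSubmersion (𝓡 e) (𝓡 b) ∞ π) :
    omN = omN' ∧ lamN = lamN' :=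
  have hd := fun q => modelDeriv_surjective_of_isSubmersion hπ q
  ⟨Form.eq_of_pullback_eq hsurj hd (h.pullback_omega.trans h'.pullback_omega.symm),
    Form.eq_of_pullback_eq hsurj hd (h.pullback_lam.trans h'.pullback_lam.symm)⟩

omit [IsManifold (𝓡 d) ∞ M] [IsManifold (𝓡 b) ∞ B] in
theorem IsReduced.isLinearReduction {omN : Form b B 2} {lamN : Form b B 1}
    (h : IsReduced e om lam i π omN lamN) (hi : IsImmersion (𝓡 e) (𝓡 d) ∞ i)
    (hcoiso : IsCoisotropic e om lam i) (hπ : IsSubmersion (𝓡 e) (𝓡 b) ∞ π) (q : N) :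
    IsLinearReduction (om.alt (i q)) (lam.alt (i q)) (omN.alt (π q)) (lamN.alt (π q))
      (tanMap e d i q) (tanMap e b π q) where
  injective := modelDeriv_injective_of_isImmersion hi q
  surjective := modelDeriv_surjective_of_isSubmersion hπ q
  bilin_eq u w := by
    rw [← Form.pullback_two_apply, ← Form.pullback_two_apply, Form.pullbackVal, h.pullback_omega]
    rfl
  covector_eq u := by
    rw [← Form.pullback_one_apply, ← Form.pullback_one_apply, Form.pullbackVal, h.pullback_lam]
    rfl
  coisotropic := hcoiso q

end Reduction

/-! ### Constant-rank maps onto a manifold -/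

section ConstantRank

variable {p c r : ℕ} {P Q : Type*}
  [TopologicalSpace P] [ChartedSpace (EuclideanSpace ℝ (Fin p)) P] [IsManifold (𝓡 p) ∞ P]
  [SecondCountableTopology P]
  [TopologicalSpace Q] [ChartedSpace (EuclideanSpace ℝ (Fin c)) Q] [IsManifold (𝓡 c) ∞ Q]

/-- A smooth map of constant rank `r` from a second countable manifold onto a manifold of dimension
`c` has `c ≤ r`. -/
theorem le_of_surjective_of_finrank_range [Nonempty Q] {g : P → Q} (hg : ContMDiff (𝓡 p) (𝓡 c) ∞ g)
    (hsurj : Function.Surjective g)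
    (hr : ∀ x, Module.finrank ℝ (LinearMap.range (tanMap p c g x)) = r) : c ≤ r := by
  let φ := chartAt (EuclideanSpace ℝ (Fin c)) (Classical.arbitrary Q)
  have hmem : φ ∈ IsManifold.maximalAtlas (𝓡 c) ∞ Q := IsManifold.chart_mem_maximalAtlas _
  have hφ : φ.MDifferentiable (𝓡 c) (𝓡 c) := mdifferentiable_of_mem_maximalAtlas hmem
  have hW : IsOpen (g ⁻¹' φ.source) := φ.open_source.preimage hg.continuous
  have hsm : ContMDiffOn (𝓡 p) (𝓡 c) ∞ (φ ∘ g) (g ⁻¹' φ.source) :=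
    (contMDiffOn_of_mem_maximalAtlas hmem).comp hg.contMDiffOn fun _ h => h
  have hdim := dimH_image_le_of_finrank_range_mfderiv hW hsm (r := r) fun x hx => by
    have h1 : (modelDeriv (𝓡 p) (𝓡 c) (φ ∘ g) x :
        EuclideanSpace ℝ (Fin p) →ₗ[ℝ] EuclideanSpace ℝ (Fin c)) =
        (modelDeriv (𝓡 c) (𝓡 c) φ (g x) :
          EuclideanSpace ℝ (Fin c) →ₗ[ℝ] EuclideanSpace ℝ (Fin c)) ∘ₗ tanMap p c g x :=
      LinearMap.ext fun v => modelDeriv_comp (hφ.mdifferentiableAt hx)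
        (hg.mdifferentiable (by simp) x) v
    have h2 : Module.finrank ℝ (LinearMap.range (modelDeriv (𝓡 p) (𝓡 c) (φ ∘ g) x :
        EuclideanSpace ℝ (Fin p) →ₗ[ℝ] EuclideanSpace ℝ (Fin c))) = r := by
      rw [h1, LinearMap.range_comp, ← hr x]
      exact LinearEquiv.finrank_eq
        (Submodule.equivMapOfInjective _ (modelDeriv_injective hφ hx) _).symm
    exact h2
  -- The image contains a nonempty open set of a `c`-dimensional space, so its Hausdorff dimension
  -- is at least `c`.
  have himage : φ.target ⊆ (φ ∘ g) '' (g ⁻¹' φ.source) := by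
    intro z hz
    obtain ⟨x, hx⟩ := hsurj (φ.symm z)
    exact ⟨x, by rw [mem_preimage, hx]; exact φ.map_target hz,
      by rw [Function.comp_apply, hx, φ.right_inv hz]⟩
  have h := (dimH_mono himage).trans hdim
  rw [Real.dimH_of_nonempty_interior, finrank_euclideanSpace_fin] at h
  · exact_mod_cast h
  · rw [φ.open_target.interior_eq]
    exact ⟨_, mem_chart_target _ (Classical.arbitrary Q)⟩

end ConstantRank

/-! ### Smooth lifts to embedded submanifolds -/

section Lift

variable {e d p : ℕ} {M N P : Type*}
  [TopologicalSpace M] [ChartedSpace (EuclideanSpace ℝ (Fin d)) M]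
  [TopologicalSpace N] [ChartedSpace (EuclideanSpace ℝ (Fin e)) N]
  [TopologicalSpace P] [ChartedSpace (EuclideanSpace ℝ (Fin p)) P]

/-- A smooth map with values in an embedded submanifold is smooth as a map to the submanifold. -/
theorem exists_contMDiff_lift {f : N → M} (hf : IsImmersion (𝓡 e) (𝓡 d) ∞ f)
    (hfe : Topology.IsEmbedding f) {g : P → M} (hg : ContMDiff (𝓡 p) (𝓡 d) ∞ g)
    (hrange : range g ⊆ range f) :
    ∃ g' : P → N, ContMDiff (𝓡 p) (𝓡 e) ∞ g' ∧ ∀ x, f (g' x) = g x := by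
  choose g' hg' using fun x => hrange (mem_range_self x)
  have hfg : f ∘ g' = g := funext hg'
  refine ⟨g', ?_, hg'⟩
  rw [ContMDiff.iff_comp_isImmersion hf, hfe.isInducing.continuous_iff, hfg]
  exact ⟨hg.continuous, hg⟩

theorem tanMap_injective {f : N → M} (hf : IsImmersion (𝓡 e) (𝓡 d) ∞ f) (q : N) :
    Function.Injective (tanMap e d f q) := modelDeriv_injective_of_isImmersion hf q

theorem tanMap_comp {f : N → M} {g : P → N} (hf : ContMDiff (𝓡 e) (𝓡 d) ∞ f)
    (hg : ContMDiff (𝓡 p) (𝓡 e) ∞ g) (x : P) :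
    tanMap p d (f ∘ g) x = tanMap e d f (g x) ∘ₗ tanMap p e g x :=
  LinearMap.ext fun v => modelDeriv_comp (hf.mdifferentiable (by simp) _)
    (hg.mdifferentiable (by simp) x) v

end Lift

/-! ### Reduction of Lagrangian submanifolds -/

section Lagrangian

variable {d e b l p c : ℕ} {M N B L P Q : Type*}
  [TopologicalSpace M] [ChartedSpace (EuclideanSpace ℝ (Fin d)) M]
  [TopologicalSpace N] [ChartedSpace (EuclideanSpace ℝ (Fin e)) N]
  [TopologicalSpace B] [ChartedSpace (EuclideanSpace ℝ (Fin b)) B]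
  [TopologicalSpace L] [ChartedSpace (EuclideanSpace ℝ (Fin l)) L]
  [TopologicalSpace P] [ChartedSpace (EuclideanSpace ℝ (Fin p)) P] [IsManifold (𝓡 p) ∞ P]
  [SecondCountableTopology P]
  [TopologicalSpace Q] [ChartedSpace (EuclideanSpace ℝ (Fin c)) Q] [IsManifold (𝓡 c) ∞ Q]
  {om : Form d M 2} {lam : Form d M 1} {omN : Form b B 2} {lamN : Form b B 1}
  {i : N → M} {π : N → B} {j : L → M} {k : P → M} {f : Q → B}

/-- The projection to `T_{π q} B` of the tangent space of the intersection of `N` and `L`. -/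
noncomputable def projTan (d e b p : ℕ) {M N B P : Type*}
    [TopologicalSpace M] [ChartedSpace (EuclideanSpace ℝ (Fin d)) M]
    [TopologicalSpace N] [ChartedSpace (EuclideanSpace ℝ (Fin e)) N]
    [TopologicalSpace B] [ChartedSpace (EuclideanSpace ℝ (Fin b)) B]
    [TopologicalSpace P] [ChartedSpace (EuclideanSpace ℝ (Fin p)) P]
    (i : N → M) (π : N → B) (k : P → M) (x : P) (q : N) :
    Submodule ℝ (EuclideanSpace ℝ (Fin b)) :=
  ((tanSpace p d k x).comap (tanMap e d i q)).map (tanMap e b π q)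

omit [IsManifold (𝓡 p) ∞ P] [SecondCountableTopology P] in
theorem IsCleanIntersection.projTan_eq (hk : IsCleanIntersection d e l p i j k) {x : P} {q : N}
    {z : L} (hq : i q = k x) (hz : j z = k x) :
    projTan d e b p i π k x q =
      ((tanSpace l d j z).comap (tanMap e d i q)).map (tanMap e b π q) := by
  rw [projTan, hk.tan_eq x q z hq hz, Submodule.comap_inf]
  have : (tanSpace e d i q).comap (tanMap e d i q) = ⊤ :=
    eq_top_iff.2 fun v _ => LinearMap.mem_range_self (tanMap e d i q) v
  rw [this, top_inf_eq]

omit [SecondCountableTopology P] [IsManifold (𝓡 p) ∞ P] in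
/-- The projected tangent spaces have constant dimension if the intersection is horizontal or
non-horizontal. -/
theorem IsCleanIntersection.finrank_projTan (hk : IsCleanIntersection d e l p i j k)
    (hM : IsStableHamiltonian om lam) (hB : IsReduced e om lam i π omN lamN)
    (hi : IsImmersion (𝓡 e) (𝓡 d) ∞ i) (hcoiso : IsCoisotropic e om lam i)
    (hvert : IsVertical e om lam i) (hπ : IsSubmersion (𝓡 e) (𝓡 b) ∞ π)
    (hj : IsLagrangian l om lam j)
    (hhor : (∀ x, tanSpace p d k x ≤ hor lam (k x)) ∨ ∀ x, ¬ tanSpace p d k x ≤ hor lam (k x))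
    {x x' : P} {q q' : N} (hq : i q = k x) (hq' : i q' = k x') :
    Module.finrank ℝ (projTan d e b p i π k x q) =
      Module.finrank ℝ (projTan d e b p i π k x' q') := by
  -- Here `dim (TN ∩ TL) = p` by cleanness, so the projected dimension depends on the point only
  -- through the horizontal part of `T(L ∩ N)`.
  have key : ∀ (x : P) (q : N), i q = k x → 2 * (Module.finrank ℝ (projTan d e b p i π k x q) +
      Module.finrank ℝ ↥(tanSpace p d k x ⊓ hor lam (k x))) + d + 1 = 2 * (p + e) := by
    intro x q hq
    obtain ⟨-, z, hz⟩ : k x ∈ range i ∩ range j := hk.range_eq ▸ mem_range_self x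
    obtain ⟨R, hR⟩ := hM.exists_isReebVector (i q)
    obtain ⟨R', hR'⟩ := hB.stable.exists_isReebVector (π q)
    have hL : orth (om.alt (j z)) (lam.alt (j z)) (tanSpace l d j z) =
        tanSpace l d j z ⊓ horizontal (lam.alt (j z)) := hj z
    rw [hz, ← hq] at hL
    have h := (hB.isLinearReduction hi hcoiso hπ q).finrank_map_comap hR hR' (hvert.mem_range hR) hL
    have hp : Module.finrank ℝ (tanSpace p d k x) = p :=
      (LinearMap.finrank_range_of_inj (f := tanMap p d k x)
        (tanMap_injective hk.submanifold.immersion x)).trans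
        finrank_euclideanSpace_fin
    rw [hk.projTan_eq hq hz, ← hq]
    rw [hk.tan_eq x q z hq hz] at hp ⊢
    rw [finrank_euclideanSpace_fin, finrank_euclideanSpace_fin] at h
    rw [← hp]
    exact h
  -- That horizontal part has dimension `p` everywhere or `p - 1` everywhere.
  have hhor' : Module.finrank ℝ ↥(tanSpace p d k x ⊓ hor lam (k x)) =
      Module.finrank ℝ ↥(tanSpace p d k x' ⊓ hor lam (k x')) := by
    have hp : ∀ x, Module.finrank ℝ (tanSpace p d k x) = p := fun x =>
      (LinearMap.finrank_range_of_inj (f := tanMap p d k x)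
        (tanMap_injective hk.submanifold.immersion x)).trans
        finrank_euclideanSpace_fin
    rcases hhor with h | h
    · rw [inf_eq_left.2 (h x), inf_eq_left.2 (h x'), hp, hp]
    · have h1 : ∀ x, Module.finrank ℝ ↥(tanSpace p d k x ⊓ hor lam (k x)) + 1 = p := fun x =>
        (finrank_inf_horizontal (h x)).trans (hp x)
      have := h1 x
      have := h1 x'
      omega
  have h1 := key x q hq
  have h2 := key x' q' hq'
  omega

omit [SecondCountableTopology P] [IsManifold (𝓡 p) ∞ P] [IsManifold (𝓡 c) ∞ Q] in
/-- The intersection maps smoothly onto its projection, with the projected tangent spaces as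
images of its tangent spaces. -/
theorem IsCleanIntersection.exists_projection (hk : IsCleanIntersection d e l p i j k)
    (hi : IsImmersion (𝓡 e) (𝓡 d) ∞ i) (hie : Topology.IsEmbedding i)
    (hπ : ContMDiff (𝓡 e) (𝓡 b) ∞ π) (hf : IsSmoothEmbedding (𝓡 c) (𝓡 b) ∞ f)
    (hrange : range f = π '' (i ⁻¹' range j)) :
    ∃ g : P → Q, ContMDiff (𝓡 p) (𝓡 c) ∞ g ∧ Function.Surjective g ∧
      ∀ x q, i q = k x → f (g x) = π q ∧ projTan d e b p i π k x q =
        (LinearMap.range (tanMap p c g x)).map (tanMap c b f (g x)) := by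
  have hkN : ∀ x, k x ∈ range i ∩ range j := fun x => hk.range_eq ▸ mem_range_self x
  -- Embeddedness of `N` makes `L ∩ N` map smoothly into `N`; embeddedness of `L_N` does the same
  -- for its projection.
  obtain ⟨k', hk's, hk'⟩ := exists_contMDiff_lift hi hie hk.submanifold.immersion.contMDiff
    (range_subset_iff.2 fun x => (hkN x).1)
  obtain ⟨g, hgs, hg⟩ := exists_contMDiff_lift hf.isImmersion hf.isEmbedding (hπ.comp hk's) (by
    rintro _ ⟨x, rfl⟩
    rw [hrange]
    exact ⟨k' x, by rw [mem_preimage, hk']; exact (hkN x).2, rfl⟩)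
  refine ⟨g, hgs, fun y => ?_, fun x q hq => ?_⟩
  · obtain ⟨q, ⟨z, hz⟩, hqy⟩ : f y ∈ π '' (i ⁻¹' range j) := hrange ▸ mem_range_self y
    obtain ⟨x, hx⟩ : i q ∈ range k := by rw [hk.range_eq]; exact ⟨⟨q, rfl⟩, z, hz⟩
    refine ⟨x, hf.isEmbedding.injective ?_⟩
    rw [hg, Function.comp_apply, hie.injective ((hk' x).trans hx), hqy]
  · obtain rfl : k' x = q := hie.injective ((hk' x).trans hq.symm)
    refine ⟨hg x, ?_⟩
    have h1 : tanMap p d k x = tanMap e d i (k' x) ∘ₗ tanMap p e k' x := by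
      rw [← tanMap_comp hi.contMDiff hk's, show i ∘ k' = k from funext hk']
    have h2 : tanMap e b π (k' x) ∘ₗ tanMap p e k' x = tanMap c b f (g x) ∘ₗ tanMap p c g x := by
      rw [← tanMap_comp hπ hk's, ← tanMap_comp hf.isImmersion.contMDiff hgs,
        show f ∘ g = π ∘ k' from funext hg]
    have h3 : tanSpace p d k x = (LinearMap.range (tanMap p e k' x)).map (tanMap e d i (k' x)) := by
      rw [← LinearMap.range_comp, ← h1]; rfl
    rw [projTan, h3, Submodule.comap_map_eq_of_injective (tanMap_injective hi _),
      ← LinearMap.range_comp, h2, LinearMap.range_comp]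

omit [SecondCountableTopology P] [IsManifold (𝓡 p) ∞ P] [IsManifold (𝓡 c) ∞ Q] in
theorem IsCleanIntersection.projTan_le_tanSpace (hk : IsCleanIntersection d e l p i j k)
    (hi : IsImmersion (𝓡 e) (𝓡 d) ∞ i) (hie : Topology.IsEmbedding i)
    (hπ : ContMDiff (𝓡 e) (𝓡 b) ∞ π) (hf : IsSmoothEmbedding (𝓡 c) (𝓡 b) ∞ f)
    (hrange : range f = π '' (i ⁻¹' range j)) {x : P} {q : N} {y : Q} (hq : i q = k x)
    (hy : f y = π q) : projTan d e b p i π k x q ≤ tanSpace c b f y := by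
  obtain ⟨g, -, -, hg⟩ := hk.exists_projection hi hie hπ hf hrange
  obtain ⟨hgx, hproj⟩ := hg x q hq
  obtain rfl : g x = y := hf.isEmbedding.injective (hgx.trans hy.symm)
  rw [hproj]
  exact LinearMap.map_le_range

/-- The projection `L ∩ N → L_N` is onto and of constant rank, so its rank is at least `c = dim
L_N`, which forces equality in `projTan_le_tanSpace`. -/
theorem IsCleanIntersection.projTan_eq_tanSpace (hk : IsCleanIntersection d e l p i j k)
    (hi : IsImmersion (𝓡 e) (𝓡 d) ∞ i) (hie : Topology.IsEmbedding i)
    (hπ : ContMDiff (𝓡 e) (𝓡 b) ∞ π) (hf : IsSmoothEmbedding (𝓡 c) (𝓡 b) ∞ f)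
    (hrange : range f = π '' (i ⁻¹' range j))
    (hrank : ∀ x x' q q', i q = k x → i q' = k x' →
      Module.finrank ℝ (projTan d e b p i π k x q) =
        Module.finrank ℝ (projTan d e b p i π k x' q'))
    {x : P} {q : N} {y : Q} (hq : i q = k x) (hy : f y = π q) :
    projTan d e b p i π k x q = tanSpace c b f y := by
  obtain ⟨g, hgs, hsurj, hg⟩ := hk.exists_projection hi hie hπ hf hrange
  have hrank' : ∀ x q, i q = k x → Module.finrank ℝ (projTan d e b p i π k x q) =
      Module.finrank ℝ (LinearMap.range (tanMap p c g x)) := fun x q hq => by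
    rw [(hg x q hq).2]
    exact LinearEquiv.finrank_eq (Submodule.equivMapOfInjective _
      (tanMap_injective hf.isImmersion _) _).symm
  have : Nonempty Q := ⟨y⟩
  have hc : c ≤ Module.finrank ℝ (projTan d e b p i π k x q) :=
    le_of_surjective_of_finrank_range hgs hsurj fun x' => by
      obtain ⟨⟨q', hq'⟩, -⟩ : k x' ∈ range i ∩ range j := hk.range_eq ▸ mem_range_self x'
      rw [← hrank' x' q' hq', hrank x' x q' q hq' hq]
  refine Submodule.eq_of_le_of_finrank_le (hk.projTan_le_tanSpace hi hie hπ hf hrange hq hy) ?_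
  exact ((LinearMap.finrank_range_le (tanMap c b f y)).trans_eq finrank_euclideanSpace_fin).trans hc

omit [IsManifold (𝓡 c) ∞ Q] [IsManifold (𝓡 p) ∞ P] [SecondCountableTopology P] in
-- Once `T L_N = dπ(T(L ∩ N))` is known, the claim is `orth_map_comap` at each point.
theorem IsCleanIntersection.isLagrangian (hk : IsCleanIntersection d e l p i j k)
    (hM : IsStableHamiltonian om lam) (hB : IsReduced e om lam i π omN lamN)
    (hi : IsImmersion (𝓡 e) (𝓡 d) ∞ i) (hcoiso : IsCoisotropic e om lam i)
    (hvert : IsVertical e om lam i) (hπ : IsSubmersion (𝓡 e) (𝓡 b) ∞ π)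
    (hj : IsLagrangian l om lam j) (hrange : range f = π '' (i ⁻¹' range j))
    (htan : ∀ x q y, i q = k x → f y = π q → projTan d e b p i π k x q = tanSpace c b f y) :
    IsLagrangian c omN lamN f := by
  intro y
  obtain ⟨q, ⟨z, hz⟩, hqy⟩ : f y ∈ π '' (i ⁻¹' range j) := hrange ▸ mem_range_self y
  obtain ⟨x, hx⟩ : i q ∈ range k := by rw [hk.range_eq]; exact ⟨⟨q, rfl⟩, z, hz⟩
  obtain ⟨R, hR⟩ := hM.exists_isReebVector (i q)
  obtain ⟨R', hR'⟩ := hB.stable.exists_isReebVector (π q)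
  have hL : orth (om.alt (j z)) (lam.alt (j z)) (tanSpace l d j z) =
      tanSpace l d j z ⊓ horizontal (lam.alt (j z)) := hj z
  rw [hz] at hL
  have h := (hB.isLinearReduction hi hcoiso hπ q).orth_map_comap hR hR' (hvert.mem_range hR) hL
  rw [← hk.projTan_eq hx.symm (hz.trans hx.symm), htan x q y hx.symm hqy.symm, hqy] at h
  exact h

end Lagrangian
end SHS

theorem mainTheorem9
    {d e b : ℕ} {M N B : Type*}
    [TopologicalSpace M] [ChartedSpace (EuclideanSpace ℝ (Fin d)) M] [IsManifold (𝓡 d) ∞ M]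
    [T2Space M] [SecondCountableTopology M]
    [TopologicalSpace N] [ChartedSpace (EuclideanSpace ℝ (Fin e)) N] [IsManifold (𝓡 e) ∞ N]
    [T2Space N] [SecondCountableTopology N] [Nonempty N]
    [TopologicalSpace B] [ChartedSpace (EuclideanSpace ℝ (Fin b)) B] [IsManifold (𝓡 b) ∞ B]
    [T2Space B] [SecondCountableTopology B]
    (om : SHS.Form d M 2) (lam : SHS.Form d M 1) (hM : SHS.IsStableHamiltonian om lam)
    (i : N → M) (hi : SHS.IsSubmanifold e d i)
    (hcoiso : SHS.IsCoisotropic e om lam i) (hvert : SHS.IsVertical e om lam i)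
    (hint : SHS.IsIntegrable (SHS.charDistribution e om lam i))
    (π : N → B) (hleaf : SHS.IsLeafProjection (SHS.charDistribution e om lam i) π)
    (hπ : Manifold.IsSubmersion (𝓡 e) (𝓡 b) ∞ π)
    -- `i^* d lam` vanishes on `TN ∩ ker lam`
    (hdlam : ∀ (q : N) (u v : TangentSpace (𝓡 e) q),
      lam.pullback e i q ![u] = 0 → lam.pullback e i q ![v] = 0 →
        lam.extD.pullback e i q ![u, v] = 0) :
    (∃! r : SHS.Form b B 2 × SHS.Form b B 1,
      SHS.IsReduced e om lam i π r.1 r.2) ∧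
    -- projection of Lagrangian submanifolds
    (Topology.IsEmbedding i →
      ∀ (omN : SHS.Form b B 2) (lamN : SHS.Form b B 1),
      SHS.IsReduced e om lam i π omN lamN →
      ∀ {l p c : ℕ} {L P Q : Type*}
        [TopologicalSpace L] [ChartedSpace (EuclideanSpace ℝ (Fin l)) L] [IsManifold (𝓡 l) ∞ L]
        [T2Space L] [SecondCountableTopology L]
        [TopologicalSpace P] [ChartedSpace (EuclideanSpace ℝ (Fin p)) P] [IsManifold (𝓡 p) ∞ P]
        [T2Space P] [SecondCountableTopology P]
        [TopologicalSpace Q] [ChartedSpace (EuclideanSpace ℝ (Fin c)) Q] [IsManifold (𝓡 c) ∞ Q]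
        [T2Space Q] [SecondCountableTopology Q]
        (j : L → M) (k : P → M) (f : Q → B),
      SHS.IsSubmanifold l d j → SHS.IsLagrangian l om lam j →
      SHS.IsCleanIntersection d e l p i j k →
      -- `π(L ∩ N)` is an embedded submanifold
      Manifold.IsSmoothEmbedding (𝓡 c) (𝓡 b) ∞ f → Set.range f = π '' (i ⁻¹' Set.range j) →
      -- `L ∩ N` is horizontal, or it is non-horizontal, or `π : L ∩ N → π(L ∩ N)` is a submersion
      ((∀ x, SHS.tanSpace p d k x ≤ SHS.hor lam (k x)) ∨
        (∀ x, ¬ SHS.tanSpace p d k x ≤ SHS.hor lam (k x)) ∨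
        (∀ x q y, i q = k x → f y = π q →
          SHS.tanSpace c b f y ≤
            ((SHS.tanSpace p d k x).comap (mfderiv (𝓡 e) (𝓡 d) i q :
                TangentSpace (𝓡 e) q →ₗ[ℝ] TangentSpace (𝓡 d) (i q))).map
              (mfderiv (𝓡 e) (𝓡 b) π q :
                TangentSpace (𝓡 e) q →ₗ[ℝ] TangentSpace (𝓡 b) (π q)))) →
      SHS.IsLagrangian c omN lamN f) := by
  refine ⟨?_, ?_⟩
  · obtain ⟨omN, lamN, h⟩ := hM.exists_isReduced hi.immersion.contMDiff hvert hleaf hπ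
      (hvert.pullbackVal_extD_eq_zero hM hdlam)
    refine ⟨(omN, lamN), h, fun r hr => ?_⟩
    have := hr.eq h hleaf.1 hπ
    exact Prod.ext this.1 this.2
  · intro hie omN lamN hB l p c L P Q _ _ _ _ _ _ _ _ _ _ _ _ _ _ _ j k f hj hjL hk hf hrange hcases
    refine hk.isLagrangian hM hB hi.immersion hcoiso hvert hπ hjL hrange fun x q y hq hy => ?_
    have hconst (hhor : (∀ x, SHS.tanSpace p d k x ≤ SHS.hor lam (k x)) ∨
        ∀ x, ¬ SHS.tanSpace p d k x ≤ SHS.hor lam (k x)) :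
        SHS.projTan d e b p i π k x q = SHS.tanSpace c b f y :=
      hk.projTan_eq_tanSpace hi.immersion hie hπ.contMDiff hf hrange (fun _ _ _ _ =>
        hk.finrank_projTan hM hB hi.immersion hcoiso hvert hπ hjL hhor) hq hy
    rcases hcases with h | h | h
    · exact hconst (Or.inl h)
    · exact hconst (Or.inr h)
    -- The submersion hypothesis is exactly the inclusion opposite to the chain rule, so no rank
    -- argument is needed.
    · exact le_antisymm
        (hk.projTan_le_tanSpace hi.immersion hie hπ.contMDiff hf hrange hq hy) (h x q y hq hy)
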